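/- Let $K$ be a compact metric space, and let $C(K)$ be the Banach space of continuous real functions on $K$ with the supremum norm. Let $B_1(K)$ be the set of all $F:K\to\mathbb R$ that are pointwise limits of uniformly bounded sequences in $C(K)$. Let $DBSC(K)$ be the set of all $F:K\to\mathbb R$ for which there are $(f_n)_{n\ge 0}\subseteq C(K)$ and $C<\infty$ such that $f_0=0$, $f_n\to F$ pointwise, and $\sum_{n\ge 0}|f_{n+1}(k)-f_n(k)|\le C$ for all $k\in K$. Let $B_{1/2}(K)$ be the set of all $F\in B_1(K)$ that are uniform limits of sequences in $DBSC(K)$. A basic sequence in a Banach space is a sequence that is a Schauder basis of its closed linear span; a sequence $(x_n)$ is seminormalized if $0<\inf_n\|x_n\|\le\sup_n\|x_n\|<\infty$. A basic sequence $(e_n)$ in a Banach space is a spreading model of a seminormalized basic sequence $(x_n)$ if for all $k\in\mathbb N$ and $\varepsilon>0$ there is $N$ such that $$\Big|\,\Big\|\sum_{i=1}^k a_i x_{n_i}\Big\|-\Big\|\sum_{i=1}^k a_i e_i\Big\|\,\Big|<\varepsilon$$ whenever $N<n_1<\dots<n_k$ and $a_1,\dots,a_k\in\mathbb R$ satisfy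 $\max_i|a_i|\le 1$ (a sequence that is not a seminormalized basic sequence has no spreading model). Two sequences $(x_n)$, $(y_n)$ are equivalent if there are $A,B>0$ with $A\|\sum_i a_iy_i\|\le\|\sum_i a_ix_i\|\le B\|\sum_i a_iy_i\|$ for all finitely supported real $(a_i)$. A sequence $(g_n)$ is a convex block subsequence of $(f_n)$ if $g_n=\sum_{i=p_n+1}^{p_{n+1}}a_if_i$ for some strictly increasing sequence of integers $p_n\ge 0$ and some $a_i\ge0$ with $\sum_{i=p_n+1}^{p_{n+1}}a_i=1$ for all $n$. **Theorem 3.7.** Let $F\in B_1(K)$. 1. Suppose that $F\notin C(K)$ and that, whenever $(f_n)\subseteq C(K)$ is a uniformly bounded sequence converging pointwise to $F$, every spreading model of $(f_n)$ is equivalent to the unit vector basis of $\ell_1$. Then $F\notin B_{1/2}(K)$. 2. Moreover, $F\notin B_{1/2}(K)$ if and only if there is a uniformly bounded sequence $(f_n)\subseteq C(K)$ converging pointwise to $F$ such that every convex block subsequence of $(f_n)$ has a subsequence with a spreading model equivalent to the unit vector basis of $\ell_1$. -/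

import Mathlib

open Filter Topology

/-- `f` is a uniformly bounded sequence in `C(K)` which converges pointwise to `F`. -/
def BddConvergesTo {K : Type*} [TopologicalSpace K] (f : ℕ → C(K, ℝ)) (F : K → ℝ) : Prop :=
  (∃ M : ℝ, ∀ n k, |f n k| ≤ M) ∧ ∀ k, Tendsto (fun n => f n k) atTop (𝓝 (F k))

/-- `B₁(K)`: the bounded Baire-1 functions on `K`. -/
def BaireOne (K : Type*) [TopologicalSpace K] : Set (K → ℝ) :=
  {F | ∃ f : ℕ → C(K, ℝ), BddConvergesTo f F}

/-- `DBSC(K)`: the differences of bounded semicontinuous functions on `K`, i.e. the pointwise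
limits of sequences `0 = f₀, f₁, f₂, …` in `C(K)` for which the sums
`∑ₙ |fₙ₊₁(k) - fₙ(k)|` are bounded by a constant independent of `k`. The bound on the series of
nonnegative terms is expressed through its partial sums. -/
def DBSC (K : Type*) [TopologicalSpace K] : Set (K → ℝ) :=
  {F | ∃ (f : ℕ → C(K, ℝ)) (C : ℝ), f 0 = 0 ∧
    (∀ k, Tendsto (fun n => f n k) atTop (𝓝 (F k))) ∧
    ∀ k N, ∑ n ∈ Finset.range N, |f (n + 1) k - f n k| ≤ C}

/-- `B_{1/2}(K)`: the functions in `B₁(K)` that are uniform limits of sequences in `DBSC(K)`. -/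
def BaireHalf (K : Type*) [TopologicalSpace K] : Set (K → ℝ) :=
  {F | F ∈ BaireOne K ∧
    ∃ G : ℕ → K → ℝ, (∀ n, G n ∈ DBSC K) ∧ TendstoUniformly G F atTop}

/-- `x` is a basic sequence: it is a Schauder basis of its closed linear span. -/
def IsBasicSequence {X : Type*} [NormedAddCommGroup X] [NormedSpace ℝ X] (x : ℕ → X) : Prop :=
  ∃ b : SchauderBasis ℝ (Submodule.span ℝ (Set.range x)).topologicalClosure,
    ∀ n, (b.basis n : X) = x n

/-- `x` is seminormalized: its norms are bounded, and bounded away from `0`. -/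
def IsSeminormalized {X : Type*} [NormedAddCommGroup X] (x : ℕ → X) : Prop :=
  ∃ c C : ℝ, 0 < c ∧ ∀ n, c ≤ ‖x n‖ ∧ ‖x n‖ ≤ C

/-- The sequence `e` is a spreading model of the sequence `x`: here `x` is a seminormalized basic
sequence, `e` is a basic sequence, and for all `k` and `ε > 0` there is `N` such that
`|‖∑ aᵢ x_{nᵢ}‖ - ‖∑ aᵢ eᵢ‖| < ε` whenever `N < n₁ < ⋯ < nₖ` and `|aᵢ| ≤ 1`. -/
def IsSpreadingModel {X E : Type*} [NormedAddCommGroup X] [NormedSpace ℝ X]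
    [NormedAddCommGroup E] [NormedSpace ℝ E] (x : ℕ → X) (e : ℕ → E) : Prop :=
  IsSeminormalized x ∧ IsBasicSequence x ∧ IsBasicSequence e ∧
  ∀ (k : ℕ) (ε : ℝ), 0 < ε → ∃ N : ℕ, ∀ n : Fin k → ℕ, StrictMono n → (∀ i, N < n i) →
    ∀ a : Fin k → ℝ, (∀ i, |a i| ≤ 1) →
      |‖∑ i, a i • x (n i)‖ - ‖∑ i, a i • e i‖| < ε

/-- Equivalence of sequences in normed spaces: `∑ aᵢ xᵢ ↦ ∑ aᵢ yᵢ` is an isomorphism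
between the linear spans. -/
def EquivalentSequences {X Y : Type*} [NormedAddCommGroup X] [NormedSpace ℝ X]
    [NormedAddCommGroup Y] [NormedSpace ℝ Y] (x : ℕ → X) (y : ℕ → Y) : Prop :=
  ∃ A B : ℝ, 0 < A ∧ 0 < B ∧ ∀ (n : ℕ) (a : ℕ → ℝ),
    A * ‖∑ i ∈ Finset.range n, a i • y i‖ ≤ ‖∑ i ∈ Finset.range n, a i • x i‖ ∧
    ‖∑ i ∈ Finset.range n, a i • x i‖ ≤ B * ‖∑ i ∈ Finset.range n, a i • y i‖

/-- The unit vector basis of `ℓ₁`. -/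
noncomputable def ellOneBasis (n : ℕ) : lp (fun _ : ℕ => ℝ) 1 := lp.single 1 n (1 : ℝ)

/-- `x` has a spreading model, in some Banach space, that is equivalent to the unit vector basis
of `ℓ₁`. -/
def HasEllOneSpreadingModel {X : Type*} [NormedAddCommGroup X] [NormedSpace ℝ X]
    (x : ℕ → X) : Prop :=
  ∃ (E : Type) (_ : NormedAddCommGroup E) (_ : NormedSpace ℝ E) (_ : CompleteSpace E)
    (e : ℕ → E), IsSpreadingModel x e ∧ EquivalentSequences e ellOneBasis

/-- `g` is a convex block subsequence of `f`: its terms are convex combinations of the terms of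
`f` over consecutive finite blocks of indices. -/
def IsConvexBlockSubsequence {X : Type*} [AddCommGroup X] [Module ℝ X] (g f : ℕ → X) : Prop :=
  ∃ (p : ℕ → ℕ) (a : ℕ → ℝ), StrictMono p ∧ (∀ i, 0 ≤ a i) ∧
    ∀ n, ∑ i ∈ Finset.Ico (p n) (p (n + 1)), a i = 1 ∧
      g n = ∑ i ∈ Finset.Ico (p n) (p (n + 1)), a i • f i

/-!
The proof compares the lengths of the alternations of a sequence `f n t` between two levels `a < b`
with membership in `DBSC(K)`; no ordinal index is used.

*If `F ∈ B_{1/2}(K)`.* For every `ε` there is a sequence `h` in `C(K)` of uniformly bounded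
variation whose limit is `ε`-close to `F`. Given a bounded sequence `f` converging to `F`, the
functions `(|f n - h n| - ε)⁺` are bounded and tend to `0` pointwise, so convex combinations of them tend to
`0` uniformly (`exists_convexCombination_lt`, from the Hahn–Banach and Riesz–Markov–Kakutani
theorems). Hence some convex block subsequence of `f` is, for every `ε`, eventually `ε`-close to a
sequence of bounded variation (`exists_convexBlockSubsequence_near_DBSC`). Its alternating sums
`∑ (-1)ⁱ g (nᵢ)` over `2k` terms are then bounded by `C + 2kε`, so no spreading model of a
subsequence is equivalent to the basis of `ℓ₁`.

*If `F ∉ B_{1/2}(K)`.* Then there are levels `a < b` such that no `[0, 1]`-valued function in `DBSC(K)`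
is `1` on `{F > b}` and `0` on `{F < a}` (`mem_BaireHalf_of_separates`). If, for some bounded sequence
converging to `F`, the alternations between `a` and `b` had bounded length, a continuous relay
driven by the sequence would produce such a function (`exists_mem_DBSC_separates`). So all sign
patterns are realised arbitrarily far out in every bounded sequence converging to `F`, and every
spreading model of such a sequence satisfies a lower `ℓ₁`-estimate with constant `(b - a) / 2`
(`IsSpreadingModel.equivalentSequences_ellOneBasis`).

The first assertion and the second case need that a bounded sequence with discontinuous pointwise
limit has a subsequence with a spreading model
(`exists_subsequence_isSpreadingModel`). A basic subsequence is found by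
Mazur's technique applied to `f n - F` in the space of bounded functions
(`exists_strictMono_hasBasisConstant`), and the spreading model by the Brunel–Sucheston
construction (`HasBasisConstant.exists_isSpreadingModel`), with iterated ultrafilter limits in the
place of Ramsey's theorem.
-/

/-! ### Selection of subsequences -/

theorem IsCompact.eventually_forall_mem {X Y : Type*} [TopologicalSpace X] {s : Set X}
    (hs : IsCompact s) {l : Filter Y} {P : X → Y → Prop}
    (h : ∀ x ∈ s, ∀ᶠ z : X × Y in 𝓝 x ×ˢ l, P z.1 z.2) : ∀ᶠ y in l, ∀ x ∈ s, P x y := by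
  refine hs.induction_on (p := fun t => ∀ᶠ y in l, ∀ x ∈ t, P x y) (by simp)
    (fun t t' htt' H => H.mono fun y hy x hx => hy x (htt' hx))
    (fun t t' H H' => ?_) (fun x hx => ?_)
  · filter_upwards [H, H'] with y hy hy' x hx
    exact hx.elim (hy x) (hy' x)
  · obtain ⟨p, hp, q, hq, hpq⟩ := eventually_prod_iff.1 (h x hx)
    exact ⟨{z | p z}, mem_nhdsWithin_of_mem_nhds hp, hq.mono fun y hy z hz => hpq hz hy⟩

/-- Diagonal selection. The choice of `σ m` may depend on a bound `M` for all earlier values, which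
is how conditions involving `σ 0, …, σ (m - 1)` are passed to `P`. -/
theorem exists_strictMono_of_eventually {l : Filter ℕ} [NeBot l] (hl : l ≤ atTop)
    {P : ℕ → ℕ → ℕ → Prop} (h : ∀ m M, ∀ᶠ n in l, P m M n) :
    ∃ σ : ℕ → ℕ, StrictMono σ ∧ ∀ m, ∃ M, (∀ i < m, σ i < M) ∧ P m M (σ m) := by
  have h' : ∀ m M, ∃ n, M ≤ n ∧ P m M n := fun m M =>
    (((eventually_ge_atTop M).filter_mono hl).and (h m M)).exists
  choose f hf hP using h'
  let σ : ℕ → ℕ := fun n => Nat.rec (f 0 0) (fun m r => f (m + 1) (r + 1)) n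
  have hσ : StrictMono σ := strictMono_nat_of_lt_succ fun n => hf (n + 1) (σ n + 1)
  refine ⟨σ, hσ, fun m => ?_⟩
  cases m with
  | zero => exact ⟨0, by simp, hP 0 0⟩
  | succ m =>
    exact ⟨σ m + 1, fun i hi => Nat.lt_succ_of_le (hσ.monotone (Nat.lt_succ_iff.1 hi)),
      hP (m + 1) (σ m + 1)⟩

/-! ### Grunblum's criterion -/

/-- Grunblum's condition: `C` bounds the partial sum projections of the sequence `x`. The terms
of `x` are not required to be nonzero. -/
def HasBasisConstant {X : Type*} [SeminormedAddCommGroup X] [NormedSpace ℝ X] (C : ℝ) (x : ℕ → X) :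
    Prop :=
  ∀ (m n : ℕ) (a : ℕ → ℝ), m ≤ n →
    ‖∑ i ∈ Finset.range m, a i • x i‖ ≤ C * ‖∑ i ∈ Finset.range n, a i • x i‖

section
variable {X : Type*} [NormedAddCommGroup X] [NormedSpace ℝ X] {C : ℝ} {x : ℕ → X}

theorem HasBasisConstant.norm_coeff_smul_le (h : HasBasisConstant C x) {i n : ℕ} (hi : i < n)
    (a : ℕ → ℝ) : ‖a i • x i‖ ≤ 2 * C * ‖∑ j ∈ Finset.range n, a j • x j‖ := by
  have h1 := h i n a hi.le
  have h2 := h (i + 1) n a hi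
  have h3 : a i • x i =
      ∑ j ∈ Finset.range (i + 1), a j • x j - ∑ j ∈ Finset.range i, a j • x j := by
    rw [Finset.sum_range_succ]; abel
  rw [h3]
  refine (norm_sub_le _ _).trans ?_
  linarith

theorem exists_sum_range_of_mem_span {z : X} (hz : z ∈ Submodule.span ℝ (Set.range x)) :
    ∃ (n : ℕ) (a : ℕ → ℝ), (∀ i, n ≤ i → a i = 0) ∧ z = ∑ i ∈ Finset.range n, a i • x i := by
  obtain ⟨c, rfl⟩ := Finsupp.mem_span_range_iff_exists_finsupp.1 hz
  obtain ⟨n, hn⟩ := c.support.exists_nat_subset_range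
  refine ⟨n, c, fun i hi => ?_, ?_⟩
  · by_contra hne
    have := Finset.mem_range.1 (hn (Finsupp.mem_support_iff.2 hne))
    omega
  · exact Finsupp.sum_of_support_subset c hn _ (by simp)

theorem HasBasisConstant.linearIndependent (h : HasBasisConstant C x) (hx : ∀ n, x n ≠ 0) :
    LinearIndependent ℝ x := by
  rw [linearIndependent_iff]
  intro c hc
  obtain ⟨n, hn⟩ := c.support.exists_nat_subset_range
  have hs : ∑ i ∈ Finset.range n, c i • x i = 0 := by
    rw [← hc, Finsupp.linearCombination_apply]
    exact (Finsupp.sum_of_support_subset c hn (fun i b => b • x i) (by simp)).symm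
  ext i
  by_cases hi : i < n
  · have := h.norm_coeff_smul_le hi c
    rw [hs, norm_zero, mul_zero, norm_le_zero_iff] at this
    simpa [hx i] using this
  · by_contra hne
    exact hi (Finset.mem_range.1 (hn (Finsupp.mem_support_iff.2 hne)))

theorem HasBasisConstant.exists_biorthogonal (h : HasBasisConstant C x) (hx : ∀ n, x n ≠ 0) :
    ∃ f : ℕ → StrongDual ℝ X, ∀ i j, f i (x j) = if i = j then 1 else 0 := by
  have hli := h.linearIndependent hx
  suffices H : ∀ i, ∃ f : StrongDual ℝ X, ∀ j, f (x j) = if i = j then 1 else 0 by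
    choose f hf using H
    exact ⟨f, hf⟩
  intro i
  let φ : Submodule.span ℝ (Set.range x) →ₗ[ℝ] ℝ := (Finsupp.lapply i) ∘ₗ hli.repr
  have hφ : ∀ j, φ ⟨x j, Submodule.subset_span ⟨j, rfl⟩⟩ = if i = j then 1 else 0 := by
    intro j
    have : hli.repr ⟨x j, Submodule.subset_span ⟨j, rfl⟩⟩ = Finsupp.single j 1 :=
      hli.repr_eq_single j _ rfl
    simp only [φ, LinearMap.comp_apply, this, Finsupp.lapply_apply, Finsupp.single_apply, eq_comm]
  have hbound : ∀ z, ‖φ z‖ ≤ (2 * |C| / ‖x i‖) * ‖z‖ := by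
    rintro ⟨z, hz⟩
    obtain ⟨n, a, ha, hza⟩ := exists_sum_range_of_mem_span hz
    have hzφ : φ ⟨z, hz⟩ = a i := by
      have : (⟨z, hz⟩ : Submodule.span ℝ (Set.range x)) =
          ∑ j ∈ Finset.range n, a j • ⟨x j, Submodule.subset_span ⟨j, rfl⟩⟩ := by
        ext; simp [hza]
      rw [this, map_sum]
      simp only [map_smul, hφ, smul_eq_mul, mul_ite, mul_one, mul_zero, Finset.sum_ite_eq,
        Finset.mem_range]
      split_ifs with hi
      · rfl
      · exact (ha i (not_lt.1 hi)).symm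
    have hpos : 0 < ‖x i‖ := norm_pos_iff.2 (hx i)
    rw [hzφ, div_mul_eq_mul_div, le_div_iff₀ hpos, ← norm_smul]
    by_cases hi : i < n
    · refine (h.norm_coeff_smul_le hi a).trans ?_
      simp only [Submodule.coe_norm, hza]
      gcongr
      exact le_abs_self C
    · rw [ha i (not_lt.1 hi), zero_smul, norm_zero]; positivity
  obtain ⟨g, hg, -⟩ := exists_extension_norm_eq _ (φ.mkContinuous _ hbound)
  exact ⟨g, fun j => (hg ⟨x j, Submodule.subset_span ⟨j, rfl⟩⟩).trans (hφ j)⟩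

/-- **Grunblum's criterion**: nonzero vectors whose partial sum projections are uniformly bounded
form a basic sequence. -/
theorem HasBasisConstant.isBasicSequence (h : HasBasisConstant C x) (hx : ∀ n, x n ≠ 0) :
    IsBasicSequence x := by
  obtain ⟨f, hf⟩ := h.exists_biorthogonal hx
  let S := Submodule.span ℝ (Set.range x)
  let P : ℕ → X →L[ℝ] X := fun n => ∑ i ∈ Finset.range n, (f i).smulRight (x i)
  have hP : ∀ n z, P n z = ∑ i ∈ Finset.range n, f i z • x i := fun n z => by
    simp [P]
  have hfsum : ∀ n (a : ℕ → ℝ) i, f i (∑ j ∈ Finset.range n, a j • x j) =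
      if i < n then a i else 0 := fun n a i => by
    simp [hf]
  have hspan : ∀ n (a : ℕ → ℝ) k, P k (∑ j ∈ Finset.range n, a j • x j) =
      ∑ j ∈ Finset.range (min k n), a j • x j := by
    intro n a k
    rw [hP]
    simp only [hfsum, ite_smul, zero_smul]
    rw [← Finset.sum_filter]
    congr 1
    ext i
    simp
  have hbd : ∀ k, ∀ z ∈ closure (S : Set X), ‖P k z‖ ≤ C * ‖z‖ := by
    intro k
    have hcl : IsClosed {z | ‖P k z‖ ≤ C * ‖z‖} :=
      isClosed_le (by fun_prop) (by fun_prop)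
    refine fun z hz => closure_minimal ?_ hcl hz
    intro y hy
    obtain ⟨n, a, -, rfl⟩ := exists_sum_range_of_mem_span hy
    rw [Set.mem_ofPred_eq, hspan]
    exact h _ _ a (min_le_right _ _)
  have hC : 0 ≤ C := by
    have := (norm_nonneg _).trans (h 1 1 (fun _ => 1) le_rfl)
    have hpos : 0 < ‖∑ i ∈ Finset.range 1, (1 : ℝ) • x i‖ := by simpa using hx 0
    exact nonneg_of_mul_nonneg_left this hpos
  have hlim : ∀ z ∈ closure (S : Set X), Tendsto (fun n => P n z) atTop (𝓝 z) := by
    intro z hz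
    rw [Metric.tendsto_atTop]
    intro ε hε
    have hδ : 0 < ε / (C + 2) := by positivity
    obtain ⟨y, hy, hzy⟩ := Metric.mem_closure_iff.1 hz _ hδ
    obtain ⟨n, a, -, rfl⟩ := exists_sum_range_of_mem_span hy
    refine ⟨n, fun k hk => ?_⟩
    have hmem : z - ∑ i ∈ Finset.range n, a i • x i ∈ closure (S : Set X) :=
      S.topologicalClosure.sub_mem hz (S.le_topologicalClosure hy)
    have h1 := hbd k _ hmem
    rw [map_sub, hspan, min_eq_right hk] at h1
    rw [dist_eq_norm] at hzy ⊢
    set y := ∑ i ∈ Finset.range n, a i • x i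
    calc ‖P k z - z‖ = ‖(P k z - y) - (z - y)‖ := by congr 1; abel
      _ ≤ ‖P k z - y‖ + ‖z - y‖ := norm_sub_le _ _
      _ ≤ (C + 1) * ‖z - y‖ := by linarith
      _ ≤ (C + 1) * (ε / (C + 2)) := by gcongr
      _ < (C + 2) * (ε / (C + 2)) := by gcongr; linarith
      _ = ε := by field_simp
  have hmem : ∀ n, x n ∈ S.topologicalClosure := fun n =>
    S.le_topologicalClosure (Submodule.subset_span ⟨n, rfl⟩)
  refine ⟨{ basis := fun n => ⟨x n, hmem n⟩
            coord := fun n => (f n).comp S.topologicalClosure.subtypeL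
            ortho := fun i j => by simp [hf, Pi.single_apply]
            expansion := fun z => ?_ }, fun n => rfl⟩
  rw [HasSum, SummationFilter.conditional_filter_eq_map_range, tendsto_map'_iff]
  rw [tendsto_subtype_rng]
  convert hlim z z.2 using 2 with n
  simp [hP]

theorem HasBasisConstant.comp_strictMono (h : HasBasisConstant C x) {σ : ℕ → ℕ}
    (hσ : StrictMono σ) : HasBasisConstant C (x ∘ σ) := by
  intro m n a hmn
  have key : ∀ k, ∑ i ∈ Finset.range k, a i • (x ∘ σ) i =
      ∑ j ∈ Finset.range (σ k), Function.extend σ a 0 j • x j := by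
    intro k
    have h1 : (Finset.range k).image σ ⊆ Finset.range (σ k) := by
      intro j hj
      obtain ⟨i, hi, rfl⟩ := Finset.mem_image.1 hj
      exact Finset.mem_range.2 (hσ (Finset.mem_range.1 hi))
    rw [← Finset.sum_subset h1, Finset.sum_image fun i _ j _ hij => hσ.injective hij]
    · simp [hσ.injective.extend_apply]
    · intro j hj hj'
      rw [Function.extend_apply', Pi.zero_apply, zero_smul]
      rintro ⟨i, rfl⟩
      exact hj' (Finset.mem_image_of_mem _ (Finset.mem_range.2
        (hσ.lt_iff_lt.1 (Finset.mem_range.1 hj))))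
  rw [key, key]
  exact h _ _ _ (hσ.monotone hmn)

end

/-! ### Mazur's selection of basic sequences -/

section
variable {X ι : Type*} [NormedAddCommGroup X] [NormedSpace ℝ X]

/-- One step of Mazur's selection of a basic sequence: if `y` is bounded below in norm and tends
to `0` along a norming family of functionals, then far out in the sequence `y n` is almost
orthogonal to a given finite-dimensional subspace. -/
theorem eventually_norm_le_mul_norm_add_smul {γ : ι → StrongDual ℝ X}
    (hγ : ∀ i z, |γ i z| ≤ ‖z‖) (hnorm : ∀ z, ∀ r < ‖z‖, ∃ i, r < |γ i z|)
    {y : ℕ → X} {c : ℝ} (hc : 0 < c) (hy : ∀ n, c ≤ ‖y n‖)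
    (h0 : ∀ i, Tendsto (fun n => γ i (y n)) atTop (𝓝 0))
    (V : Submodule ℝ X) [FiniteDimensional ℝ V] {r : ℝ} (hr : 1 < r) :
    ∀ᶠ n in atTop, ∀ u ∈ V, ∀ b : ℝ, ‖u‖ ≤ r * ‖u + b • y n‖ := by
  have hr0 : 0 < r := one_pos.trans hr
  have hη : r⁻¹ < 1 := inv_lt_one_of_one_lt₀ hr
  set η := 1 - r⁻¹ with hηdef
  have hη0 : 0 < η := sub_pos.2 hη
  have key : ∀ᶠ n in atTop, ∀ u ∈ Metric.sphere (0 : V) 1, ∀ b : ℝ,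
      r⁻¹ ≤ ‖(u : X) + b • y n‖ := by
    refine (isCompact_sphere (0 : V) 1).eventually_forall_mem
      (P := fun (u : V) n => u ∈ Metric.sphere (0 : V) 1 → ∀ b : ℝ, r⁻¹ ≤ ‖(u : X) + b • y n‖)
      (fun u₀ hu₀ => ?_) |>.mono fun n hn u hu => hn u hu hu
    have hu₀' : ‖(u₀ : X)‖ = 1 := by simpa using hu₀
    obtain ⟨i, hi⟩ := hnorm (u₀ : X) (1 - η / 3) (by rw [hu₀']; linarith)
    have h1 : ∀ᶠ u : V in 𝓝 u₀, 1 - η / 3 < |γ i u| :=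
      (show Continuous fun u : V => |γ i u| by fun_prop).continuousAt.eventually
        (lt_mem_nhds hi)
    have h2 : ∀ᶠ n in atTop, |γ i (y n)| < η * c / 6 := by
      have := (h0 i).abs
      rw [abs_zero] at this
      exact this.eventually (gt_mem_nhds (by positivity))
    filter_upwards [h1.prod_mk h2] with ⟨u, n⟩ ⟨hu, hn⟩ hus b
    have hu' : ‖(u : X)‖ = 1 := by simpa using hus
    simp only at hu hn ⊢
    by_contra! hlt
    have hb : |b| * c ≤ 2 := by
      calc |b| * c ≤ |b| * ‖y n‖ := by gcongr; exact hy n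
        _ = ‖b • y n‖ := by rw [norm_smul, Real.norm_eq_abs]
        _ = ‖((u : X) + b • y n) - u‖ := by congr 1; abel
        _ ≤ ‖(u : X) + b • y n‖ + ‖(u : X)‖ := norm_sub_le _ _
        _ ≤ 2 := by linarith
    have h3 := hγ i ((u : X) + b • y n)
    rw [map_add, map_smul, smul_eq_mul] at h3
    have h4 : |γ i u| - |b| * |γ i (y n)| ≤ |γ i u + b * γ i (y n)| := by
      have := abs_sub_abs_le_abs_sub (γ i (u : X)) (-(b * γ i (y n)))
      rwa [abs_neg, abs_mul, sub_neg_eq_add] at this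
    have h5 : |b| * |γ i (y n)| ≤ η / 3 := by
      calc |b| * |γ i (y n)| ≤ |b| * (η * c / 6) := by gcongr
        _ = (|b| * c) * (η / 6) := by ring
        _ ≤ 2 * (η / 6) := by gcongr
        _ = η / 3 := by ring
    linarith
  filter_upwards [key] with n hn u hu b
  rcases eq_or_ne u 0 with rfl | hu0
  · rw [norm_zero]; positivity
  have hpos : 0 < ‖u‖ := norm_pos_iff.2 hu0
  have := hn ⟨‖u‖⁻¹ • u, V.smul_mem _ hu⟩ (by simp [norm_smul, hpos.ne']) (‖u‖⁻¹ * b)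
  simp only [mul_smul, ← smul_add, norm_smul, norm_inv, norm_norm] at this
  rwa [inv_mul_eq_div, le_div_iff₀ hpos, inv_mul_le_iff₀ hr0] at this

/-- Mazur's selection: `v` followed by a subsequence of `y` has basis constant `2`. -/
theorem exists_strictMono_norm_le_two_mul {γ : ι → StrongDual ℝ X}
    (hγ : ∀ i z, |γ i z| ≤ ‖z‖) (hnorm : ∀ z, ∀ r < ‖z‖, ∃ i, r < |γ i z|) (v : X)
    {y : ℕ → X} {c : ℝ} (hc : 0 < c) (hy : ∀ n, c ≤ ‖y n‖)
    (h0 : ∀ i, Tendsto (fun n => γ i (y n)) atTop (𝓝 0)) :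
    ∃ σ : ℕ → ℕ, StrictMono σ ∧ ∀ (m n : ℕ) (b : ℝ) (a : ℕ → ℝ), m ≤ n →
      ‖b • v + ∑ i ∈ Finset.range m, a i • y (σ i)‖ ≤
        2 * ‖b • v + ∑ i ∈ Finset.range n, a i • y (σ i)‖ := by
  let V : ℕ → Submodule ℝ X := fun M => Submodule.span ℝ (insert v (y '' Set.Iio M))
  have hfin : ∀ M, FiniteDimensional ℝ (V M) := fun M =>
    FiniteDimensional.span_of_finite ℝ (((Set.finite_Iio M).image y).insert v)
  -- The constants `k m` increase from `1` towards `2`, which leaves room for a loss at each step.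
  let k : ℕ → ℝ := fun m => 2 - (1 / 2) ^ m
  have hk1 : ∀ m, 1 ≤ k m := fun m => by
    have : ((1 : ℝ) / 2) ^ m ≤ 1 := pow_le_one₀ (by norm_num) (by norm_num)
    simp only [k]; linarith
  have hk2 : ∀ m, k m ≤ 2 := fun m => by
    have : (0 : ℝ) ≤ (1 / 2) ^ m := by positivity
    simp only [k]; linarith
  have hk : ∀ m, k m < k (m + 1) := fun m => by
    have : (0 : ℝ) < (1 / 2) ^ m := by positivity
    simp only [k, pow_succ]; linarith
  obtain ⟨σ, hσ, hP⟩ := exists_strictMono_of_eventually le_rfl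
    (P := fun m M n => ∀ u ∈ V M, ∀ b : ℝ, ‖u‖ ≤ k (m + 1) / k m * ‖u + b • y n‖)
    (fun m M => eventually_norm_le_mul_norm_add_smul hγ hnorm hc hy h0 (V M)
      ((one_lt_div (one_pos.trans_le (hk1 m))).2 (hk m)))
  refine ⟨σ, hσ, fun m n b a hmn => ?_⟩
  have hmono : Monotone fun m => k m * ‖b • v + ∑ i ∈ Finset.range m, a i • y (σ i)‖ := by
    refine monotone_nat_of_le_succ fun m => ?_
    obtain ⟨M, hM, hMP⟩ := hP m
    have hmem : b • v + ∑ i ∈ Finset.range m, a i • y (σ i) ∈ V M :=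
      (V M).add_mem ((V M).smul_mem _ (Submodule.subset_span (Set.mem_insert _ _)))
        ((V M).sum_mem fun i hi => (V M).smul_mem _ (Submodule.subset_span
          (Set.mem_insert_of_mem _ ⟨σ i, hM i (Finset.mem_range.1 hi), rfl⟩)))
    have := hMP _ hmem (a m)
    rw [div_mul_eq_mul_div, le_div_iff₀ (one_pos.trans_le (hk1 m)), mul_comm, add_assoc,
      ← Finset.sum_range_succ] at this
    exact this
  calc _ ≤ k m * ‖b • v + ∑ i ∈ Finset.range m, a i • y (σ i)‖ :=
        le_mul_of_one_le_left (norm_nonneg _) (hk1 m)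
    _ ≤ k n * ‖b • v + ∑ i ∈ Finset.range n, a i • y (σ i)‖ := hmono hmn
    _ ≤ _ := by gcongr; exact hk2 n

end

/-! ### Basic subsequences in spaces of continuous functions -/

/-- A discontinuous function has positive uniform distance from the continuous functions. -/
theorem exists_forall_exists_le_abs_sub {K : Type*} [TopologicalSpace K] {F : K → ℝ}
    (hF : ¬ Continuous F) :
    ∃ d > 0, ∀ h : C(K, ℝ), ∃ t, d ≤ |F t - h t| := by
  by_contra! H
  refine hF ?_
  choose! h hh using H
  have hu : TendstoUniformly (fun (n : ℕ) t => h (1 / ((n : ℝ) + 1)) t) F atTop := by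
    rw [Metric.tendstoUniformly_iff]
    intro ε hε
    obtain ⟨N, hN⟩ := exists_nat_one_div_lt hε
    filter_upwards [eventually_ge_atTop N] with n hn t
    rw [Real.dist_eq]
    refine (hh (1 / ((n : ℝ) + 1)) (by positivity) t).trans_le (le_trans ?_ hN.le)
    gcongr
  exact hu.continuous (Frequently.of_forall fun n => (h _).continuous)

section
variable {K : Type*} [TopologicalSpace K] [CompactSpace K] {F : K → ℝ}

/-- A bounded sequence in `C(K)` with a discontinuous pointwise limit `F` has a seminormalized
subsequence with a finite basis constant. In the space of bounded functions, `F` followed by a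
subsequence of `f n - F` has basis constant `2`; passing back to `f n` requires bounds for the
coefficient sums `∑ aᵢ`, given by the distance of `F` from `C(K)` for the partial sums and by the
projection onto `F` for the total sum. -/
theorem exists_strictMono_hasBasisConstant {f : ℕ → C(K, ℝ)} (hf : BddConvergesTo f F)
    (hF : ¬ Continuous F) :
    ∃ (σ : ℕ → ℕ) (C : ℝ), StrictMono σ ∧ HasBasisConstant C (f ∘ σ) ∧
      IsSeminormalized (f ∘ σ) := by
  obtain ⟨⟨M, hM⟩, hlim⟩ := hf
  obtain ⟨d, hd, hdist⟩ := exists_forall_exists_le_abs_sub hF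
  have hFM : ∀ t, |F t| ≤ M := fun t =>
    le_of_tendsto (hlim t).abs (Eventually.of_forall fun n => hM n t)
  -- The difference `f n - F` lives in the space of all bounded functions on `K`.
  let X := lp (fun _ : K => ℝ) ⊤
  let v : X := ⟨F, memℓp_infty ⟨M, by rintro _ ⟨t, rfl⟩; exact hFM t⟩⟩
  let w : ℕ → X := fun n => ⟨fun t => f n t, memℓp_infty ⟨M, by rintro _ ⟨t, rfl⟩; exact hM n t⟩⟩
  let y : ℕ → X := fun n => w n - v
  have hle : ∀ (z : X) t, |(z : K → ℝ) t| ≤ ‖z‖ := fun z t =>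
    lp.norm_apply_le_norm (by simp) z t
  let γ : K → StrongDual ℝ X := fun t => lp.evalCLM ℝ (fun _ : K => ℝ) ⊤ t
  have hnorm : ∀ z, ∀ r < ‖z‖, ∃ t, r < |γ t z| := by
    intro z r hr
    rcases lt_or_ge r 0 with h | h
    · exact ⟨(hdist 0).choose, h.trans_le (abs_nonneg _)⟩
    · by_contra! H
      exact absurd (lp.norm_le_of_forall_le h H) (not_le.2 hr)
  have hdv : ∀ (h : C(K, ℝ)) (z : X), (∀ t, (z : K → ℝ) t = h t) → d ≤ ‖v - z‖ := by
    intro h z hz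
    obtain ⟨t, ht⟩ := hdist h
    refine ht.trans ?_
    have := hle (v - z) t
    rwa [lp.coeFn_sub, Pi.sub_apply, hz] at this
  have hdy : ∀ n, d ≤ ‖y n‖ := fun n => by
    rw [← norm_neg, neg_sub]; exact hdv (f n) _ fun t => rfl
  have hv : d ≤ ‖v‖ := by
    simpa using hdv 0 0 (fun t => rfl)
  obtain ⟨σ, hσ, hσy⟩ := exists_strictMono_norm_le_two_mul (γ := γ) (fun t z => hle z t) hnorm v hd
    hdy (fun t => by
      have := (hlim t).sub_const (F t)
      rw [sub_self] at this
      exact this)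
  have hwn : ∀ (h : C(K, ℝ)) (z : X), (∀ t, (z : K → ℝ) t = h t) → ‖z‖ = ‖h‖ := by
    intro h z hz
    apply le_antisymm
    · refine lp.norm_le_of_forall_le (norm_nonneg _) fun t => ?_
      rw [hz]
      exact ContinuousMap.norm_coe_le_norm _ t
    · rw [ContinuousMap.norm_le _ (norm_nonneg _)]
      intro t
      rw [← hz]
      exact hle _ t
  have hwsum : ∀ n (a : ℕ → ℝ) t, (∑ i ∈ Finset.range n, a i • w (σ i) : X) t =
      (∑ i ∈ Finset.range n, a i • f (σ i)) t := by
    intro n a t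
    induction n with
    | zero => rfl
    | succ n ih =>
      rw [Finset.sum_range_succ, Finset.sum_range_succ, lp.coeFn_add, Pi.add_apply, ih]
      rfl
  have hsplit : ∀ n (a : ℕ → ℝ), ∑ i ∈ Finset.range n, a i • w (σ i) =
      (∑ i ∈ Finset.range n, a i) • v + ∑ i ∈ Finset.range n, a i • y (σ i) := by
    intro n a
    simp only [y, smul_sub, Finset.sum_sub_distrib, Finset.sum_smul]
    abel
  have hwnorm : ∀ n (a : ℕ → ℝ), ‖∑ i ∈ Finset.range n, a i • w (σ i)‖ =
      ‖∑ i ∈ Finset.range n, a i • f (σ i)‖ := fun n a => hwn _ _ (hwsum n a)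
  refine ⟨σ, 6 * (1 + ‖v‖ / d), hσ, ?_, d / 2, M, by positivity, fun n => ⟨?_, ?_⟩⟩
  · intro m n a hmn
    have e1 : ‖∑ i ∈ Finset.range m, a i • y (σ i)‖ ≤
        2 * ‖∑ i ∈ Finset.range n, a i • y (σ i)‖ := by
      simpa using hσy m n 0 a hmn
    -- `∑ aᵢ yᵢ` is the difference of a continuous function and `(∑ aᵢ) F`.
    have e2 : |∑ i ∈ Finset.range m, a i| * d ≤ ‖∑ i ∈ Finset.range m, a i • y (σ i)‖ := by
      set s := ∑ i ∈ Finset.range m, a i with hs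
      rcases eq_or_ne s 0 with h | h
      · rw [h, abs_zero, zero_mul]; exact norm_nonneg _
      have h1 := hdv (s⁻¹ • ∑ i ∈ Finset.range m, a i • f (σ i))
        (s⁻¹ • ∑ i ∈ Finset.range m, a i • w (σ i)) (fun t => by
          rw [lp.coeFn_smul, Pi.smul_apply, hwsum]; rfl)
      have h2 : ∑ i ∈ Finset.range m, a i • y (σ i) =
          (-s) • (v - s⁻¹ • ∑ i ∈ Finset.range m, a i • w (σ i)) := by
        rw [hsplit, ← hs, smul_sub, smul_smul, neg_mul, mul_inv_cancel₀ h]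
        simp
      rw [h2, norm_smul, norm_neg, Real.norm_eq_abs]
      gcongr
    have e3 : |∑ i ∈ Finset.range n, a i| * ‖v‖ ≤ 2 * ‖∑ i ∈ Finset.range n, a i • f (σ i)‖ := by
      rw [← hwnorm, hsplit]
      have := hσy 0 n (∑ i ∈ Finset.range n, a i) a (Nat.zero_le _)
      simpa [norm_smul] using this
    have e4 : ‖∑ i ∈ Finset.range m, a i • f (σ i)‖ ≤
        |∑ i ∈ Finset.range m, a i| * ‖v‖ + ‖∑ i ∈ Finset.range m, a i • y (σ i)‖ := by
      rw [← hwnorm, hsplit, ← Real.norm_eq_abs, ← norm_smul]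
      exact norm_add_le _ _
    have e5 : ‖∑ i ∈ Finset.range n, a i • y (σ i)‖ ≤
        ‖∑ i ∈ Finset.range n, a i • f (σ i)‖ + |∑ i ∈ Finset.range n, a i| * ‖v‖ := by
      rw [← hwnorm, hsplit, ← Real.norm_eq_abs, ← norm_smul]
      set p := (∑ i ∈ Finset.range n, a i) • v
      calc _ = ‖(p + ∑ i ∈ Finset.range n, a i • y (σ i)) - p‖ := by congr 1; abel
        _ ≤ _ := norm_sub_le _ _
    simp only [Function.comp_apply]
    set S := ‖∑ i ∈ Finset.range m, a i • f (σ i)‖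
    set T := ‖∑ i ∈ Finset.range n, a i • f (σ i)‖
    set Y := ‖∑ i ∈ Finset.range m, a i • y (σ i)‖
    set Z := ‖∑ i ∈ Finset.range n, a i • y (σ i)‖
    have e6 : Z ≤ 3 * T := by linarith
    have e7 : |∑ i ∈ Finset.range m, a i| ≤ Y / d := (le_div_iff₀ hd).2 e2
    calc S ≤ Y / d * ‖v‖ + Y := e4.trans (by gcongr)
      _ = (1 + ‖v‖ / d) * Y := by ring
      _ ≤ (1 + ‖v‖ / d) * (6 * T) := by gcongr; linarith
      _ = _ := by ring
  · have h := hσy 0 (n + 1) 1 (Pi.single n 1) (Nat.zero_le _)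
    have h1 : ‖w (σ n)‖ = ‖f (σ n)‖ := hwn _ _ fun t => rfl
    have h2 : ∑ i ∈ Finset.range (n + 1), Pi.single (M := fun _ => ℝ) n 1 i • y (σ i) =
        w (σ n) - v := by
      simp [Pi.single_apply, y]
    rw [h2, one_smul, add_sub_cancel, h1, Finset.sum_range_zero, add_zero] at h
    rw [Function.comp_apply]
    linarith
  · rw [ContinuousMap.norm_le _ ((norm_nonneg _).trans (lp.norm_le_of_forall_le
      ((abs_nonneg _).trans (hFM (hdist 0).choose)) hFM : ‖v‖ ≤ M))]
    exact fun t => hM _ t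

end

/-! ### Iterated limits along an ultrafilter -/

/-- A Ramsey-type theorem: countably many bounded functions of finite sets of integers have, along
a common subsequence, limits over the `k`-element sets whose minimum tends to infinity. The
limits are iterated limits along an ultrafilter, and the subsequence is chosen so that adding the
`i`-th term as a new maximum costs at most `2⁻ⁱ` in every iterated limit considered so far. -/
theorem exists_strictMono_forall_abs_sub_lt {φ : ℕ → Finset ℕ → ℝ}
    (hb : ∀ m, ∃ B, ∀ s, |φ m s| ≤ B) :
    ∃ σ : ℕ → ℕ, StrictMono σ ∧ ∀ m k, ∃ L, ∀ ε > 0, ∃ N, ∀ s : Finset ℕ, s.card = k →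
      (∀ i ∈ s, N ≤ i) → |φ m (s.image σ) - L| < ε := by
  choose B hB using hb
  let U : Ultrafilter ℕ := hyperfilter ℕ
  have hU : (U : Filter ℕ) ≤ atTop := Nat.hyperfilter_le_atTop
  -- `D m j s` is the `j`-fold iterated limit along `U` of `φ m (s ∪ {n₁, …, nⱼ})`.
  let D : ℕ → ℕ → Finset ℕ → ℝ := fun m j =>
    Nat.rec (φ m) (fun _ G s => limUnder (U : Filter ℕ) fun n => G (insert n s)) j
  have hlim : ∀ (g : ℕ → ℝ) (b : ℝ), (∀ n, |g n| ≤ b) → ∃ L, |L| ≤ b ∧ Tendsto g U (𝓝 L) := by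
    intro g b hg
    obtain ⟨L, hL, hL'⟩ := (isCompact_Icc (a := -b) (b := b)).ultrafilter_le_nhds (U.map g)
      (by
        rw [le_principal_iff]
        exact (Eventually.of_forall fun n => abs_le.1 (hg n) :
          ∀ᶠ n in (U : Filter ℕ), g n ∈ Set.Icc (-b) b))
    exact ⟨L, abs_le.2 hL, hL'⟩
  have hD : ∀ m j s, |D m j s| ≤ B m := by
    intro m j
    induction j with
    | zero => exact hB m
    | succ j ih =>
      intro s
      obtain ⟨L, hL, hL'⟩ := hlim (fun n => D m j (insert n s)) (B m) fun n => ih _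
      have : D m (j + 1) s = L := hL'.limUnder_eq
      rwa [this]
  have hDlim : ∀ m j s, Tendsto (fun n => D m j (insert n s)) U (𝓝 (D m (j + 1) s)) := by
    intro m j s
    obtain ⟨L, -, hL'⟩ := hlim (fun n => D m j (insert n s)) (B m) fun n => hD m j _
    exact tendsto_nhds_limUnder ⟨L, hL'⟩
  obtain ⟨σ, hσ, hP⟩ := exists_strictMono_of_eventually hU
    (P := fun m M n => ∀ m' ∈ Finset.range (m + 1), ∀ j ∈ Finset.range (m + 1),
      ∀ s ∈ (Finset.range M).powerset,
        |D m' j (insert n s) - D m' (j + 1) s| < (1 / 2) ^ m)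
    (fun m M => by
      rw [Finset.eventually_all]
      intro m' _
      rw [Finset.eventually_all]
      intro j _
      rw [Finset.eventually_all]
      intro s _
      exact (hDlim m' j s).eventually (Metric.ball_mem_nhds _ (by positivity)))
  have key : ∀ m (s : Finset ℕ) j, (∀ i ∈ s, m ≤ i ∧ s.card + j ≤ i) →
      |D m j (s.image σ) - D m (s.card + j) ∅| ≤ ∑ i ∈ s, (1 / 2 : ℝ) ^ i := by
    intro m s
    induction s using Finset.induction_on_max with
    | empty => intro j _; simp
    | insert i s hi ih =>
      intro j hj
      have hns : i ∉ s := fun h => lt_irrefl _ (hi i h)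
      rw [Finset.card_insert_of_notMem hns] at hj ⊢
      rw [Finset.image_insert, Finset.sum_insert hns]
      have h1 := ih (j + 1) fun a ha => by
        have := hj a (Finset.mem_insert_of_mem ha)
        exact ⟨this.1, by omega⟩
      obtain ⟨M, hM, hMP⟩ := hP i
      have hii := hj i (Finset.mem_insert_self _ _)
      have h2 := hMP m (Finset.mem_range.2 (by omega)) j (Finset.mem_range.2 (by omega))
        (s.image σ) (Finset.mem_powerset.2 fun a ha => by
          obtain ⟨b, hb, rfl⟩ := Finset.mem_image.1 ha
          exact Finset.mem_range.2 (hM b (hi b hb)))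
      rw [show s.card + 1 + j = s.card + (j + 1) by ring]
      exact (abs_sub_le _ _ _).trans (add_le_add h2.le h1)
  refine ⟨σ, hσ, fun m k => ⟨D m k ∅, fun ε hε => ?_⟩⟩
  obtain ⟨N, hN⟩ := exists_pow_lt_of_lt_one (show 0 < ε / (k + 1) by positivity)
    (show (1 / 2 : ℝ) < 1 by norm_num)
  refine ⟨max N (max m k), fun s hs hsN => ?_⟩
  have h1 := key m s 0 fun i hi => by
    have := hsN i hi
    omega
  rw [add_zero, hs] at h1
  calc |φ m (s.image σ) - D m k ∅| ≤ ∑ i ∈ s, (1 / 2 : ℝ) ^ i := h1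
    _ ≤ ∑ i ∈ s, (1 / 2 : ℝ) ^ N := Finset.sum_le_sum fun i hi =>
        pow_le_pow_of_le_one (by norm_num) (by norm_num) ((le_max_left _ _).trans (hsN i hi))
    _ = k * (1 / 2 : ℝ) ^ N := by rw [Finset.sum_const, hs, nsmul_eq_mul]
    _ ≤ k * (ε / (k + 1)) := by gcongr
    _ < (k + 1) * (ε / (k + 1)) := by gcongr; linarith
    _ = ε := by field_simp

section
variable {X : Type*} [NormedAddCommGroup X] [NormedSpace ℝ X]

/-! ### Existence of spreading models -/

theorem abs_norm_sum_smul_sub_le {ι : Type*} [Fintype ι] {z : ι → X} {B δ : ℝ} (hB : ∀ i, ‖z i‖ ≤ B)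
    {a b : ι → ℝ} (hab : ∀ i, |a i - b i| ≤ δ) :
    |‖∑ i, a i • z i‖ - ‖∑ i, b i • z i‖| ≤ Fintype.card ι * (δ * B) := by
  refine (abs_norm_sub_norm_le _ _).trans ?_
  rw [← Finset.sum_sub_distrib]
  refine (norm_sum_le _ _).trans ?_
  refine (Finset.sum_le_card_nsmul _ _ (δ * B) fun i _ => ?_).trans ?_
  · rw [← sub_smul, norm_smul, Real.norm_eq_abs]
    have := (abs_nonneg _).trans (hab i)
    gcongr
    exacts [hab i, hB i]
  · rw [nsmul_eq_mul]; rfl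

/-- Along a subsequence, the norm of a combination of `k` terms depends asymptotically only on the
coefficients, uniformly over bounded coefficients: the countably many rational coefficient vectors
are handled simultaneously, and the rest follows by compactness. -/
theorem exists_strictMono_norm_sum_asymptotic {x : ℕ → X} {B : ℝ} (hB : ∀ n, ‖x n‖ ≤ B) :
    ∃ σ : ℕ → ℕ, StrictMono σ ∧ ∀ (k : ℕ) (R ε : ℝ), 0 < ε → ∃ N, ∀ n n' : Fin k → ℕ,
      StrictMono n → StrictMono n' → (∀ i, N ≤ n i) → (∀ i, N ≤ n' i) →
      ∀ a : Fin k → ℝ, (∀ i, |a i| ≤ R) →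
        |‖∑ i, a i • x (σ (n i))‖ - ‖∑ i, a i • x (σ (n' i))‖| < ε := by
  have hB0 : 0 ≤ B := (norm_nonneg _).trans (hB 0)
  obtain ⟨e, he⟩ := exists_surjective_nat (Σ k, Fin k → ℚ)
  let φ : ℕ → Finset ℕ → ℝ := fun m s =>
    if h : s.card = (e m).1 then ‖∑ i, ((e m).2 i : ℝ) • x (s.orderEmbOfFin h i)‖ else 0
  have hφ : ∀ m, ∃ b, ∀ s, |φ m s| ≤ b := by
    intro m
    refine ⟨∑ i, |((e m).2 i : ℝ)| * B, fun s => ?_⟩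
    simp only [φ]
    split_ifs with h
    · rw [abs_norm]
      refine (norm_sum_le _ _).trans (Finset.sum_le_sum fun i _ => ?_)
      rw [norm_smul, Real.norm_eq_abs]
      gcongr
      exact hB _
    · rw [abs_zero]; positivity
  obtain ⟨σ, hσ, hL⟩ := exists_strictMono_forall_abs_sub_lt hφ
  have hrat : ∀ (k : ℕ) (q : Fin k → ℚ), ∃ L, ∀ ε > 0, ∃ N, ∀ n : Fin k → ℕ, StrictMono n →
      (∀ i, N ≤ n i) → |‖∑ i, (q i : ℝ) • x (σ (n i))‖ - L| < ε := by
    intro k q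
    obtain ⟨m, hm⟩ := he ⟨k, q⟩
    obtain ⟨L, hL⟩ := hL m k
    refine ⟨L, fun ε hε => ?_⟩
    obtain ⟨N, hN⟩ := hL ε hε
    refine ⟨N, fun n hn hnN => ?_⟩
    have hcard : ∀ τ : Fin k → ℕ, StrictMono τ → (Finset.univ.image τ).card = k := fun τ hτ => by
      rw [Finset.card_image_of_injective _ hτ.injective, Finset.card_univ, Fintype.card_fin]
    have h1 := hN (Finset.univ.image n) (hcard n hn) (by
      intro i hi
      obtain ⟨j, -, rfl⟩ := Finset.mem_image.1 hi
      exact hnN j)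
    rw [Finset.image_image] at h1
    convert h1 using 3
    have hσn := hσ.comp hn
    simp only [φ]
    rw [hm, dif_pos (hcard _ hσn)]
    congr 1
    refine Finset.sum_congr rfl fun i _ => ?_
    rw [← Finset.orderEmbOfFin_unique (hcard _ hσn)
      (fun i => Finset.mem_image_of_mem _ (Finset.mem_univ i)) hσn]
    rfl
  refine ⟨σ, hσ, fun k R ε hε => ?_⟩
  have hcomp : IsCompact (Set.univ.pi fun _ : Fin k => Set.Icc (-R) R) :=
    isCompact_univ_pi fun _ => isCompact_Icc
  have key := hcomp.eventually_forall_mem (l := atTop) (P := fun a N => ∀ n n' : Fin k → ℕ,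
      StrictMono n → StrictMono n' → (∀ i, N ≤ n i) → (∀ i, N ≤ n' i) →
        |‖∑ i, a i • x (σ (n i))‖ - ‖∑ i, a i • x (σ (n' i))‖| < ε) (fun a₀ _ => ?_)
  · obtain ⟨N, hN⟩ := key.exists
    exact ⟨N, fun n n' hn hn' hnN hnN' a ha => hN a
      (fun i _ => abs_le.1 (ha i)) n n' hn hn' hnN hnN'⟩
  · let δ := ε / (4 * (k * B + 1))
    have hδ : 0 < δ := by positivity
    have hδB : k * (δ * B) ≤ ε / 4 := by
      calc k * (δ * B) = (k * B) * δ := by ring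
        _ ≤ (k * B + 1) * δ := by gcongr; linarith
        _ = ε / 4 := by simp only [δ]; field_simp
    have hq : ∀ i, ∃ q : ℚ, |a₀ i - q| < δ := fun i => exists_rat_near (a₀ i) hδ
    choose q hq using hq
    obtain ⟨L, hL⟩ := hrat k q
    obtain ⟨N, hN⟩ := hL (ε / 4) (by positivity)
    have hnear : ∀ᶠ a : Fin k → ℝ in 𝓝 a₀, ∀ i, |a i - q i| < δ := by
      rw [eventually_all]
      intro i
      exact (show Continuous fun a : Fin k → ℝ => |a i - q i| by fun_prop).continuousAt.eventually
        (gt_mem_nhds (hq i))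
    filter_upwards [hnear.prod_mk (eventually_ge_atTop N)] with ⟨a, N'⟩ ⟨ha, hN'⟩ n n' hn hn' h h'
    simp only at ha hN' h h' ⊢
    have h1 := hN n hn fun i => hN'.trans (h i)
    have h2 := hN n' hn' fun i => hN'.trans (h' i)
    have h3 := abs_norm_sum_smul_sub_le (z := fun i => x (σ (n i))) (fun i => hB _)
      fun i => (ha i).le
    have h4 := abs_norm_sum_smul_sub_le (z := fun i => x (σ (n' i))) (fun i => hB _)
      fun i => (ha i).le
    rw [Fintype.card_fin] at h3 h4
    rw [abs_lt] at h1 h2 ⊢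
    rw [abs_le] at h3 h4
    constructor <;> linarith

/-- The **Brunel–Sucheston theorem**: some subsequence has a spreading model. The model is the
completion of the space of finitely supported sequences under the limit of the norms, which is
only treated as a seminorm since completion also separates points. -/
theorem HasBasisConstant.exists_isSpreadingModel {x : ℕ → X} {C : ℝ} (hx : HasBasisConstant C x)
    (hsn : IsSeminormalized x) :
    ∃ σ : ℕ → ℕ, StrictMono σ ∧ ∃ (E : Type) (_ : NormedAddCommGroup E) (_ : NormedSpace ℝ E)
      (_ : CompleteSpace E) (e : ℕ → E), IsSpreadingModel (x ∘ σ) e := by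
  obtain ⟨c, B, hc, hcB⟩ := hsn
  obtain ⟨σ, hσ, has⟩ := exists_strictMono_norm_sum_asymptotic fun n => (hcB n).2
  -- The norm of the spreading model is the limit of the norms of translated combinations.
  let T : ℕ → (ℕ →₀ ℝ) →ₗ[ℝ] X := fun N => Finsupp.linearCombination ℝ fun i => x (σ (N + i))
  have hT : ∀ N k (a : ℕ →₀ ℝ), a.support ⊆ Finset.range k →
      T N a = ∑ i : Fin k, a i • x (σ (N + i)) := by
    intro N k a ha
    rw [Fin.sum_univ_eq_sum_range (fun i => a i • x (σ (N + i))) k]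
    exact Finsupp.sum_of_support_subset a ha (fun i b => b • x (σ (N + i))) (by simp)
  have hshift : ∀ k N, StrictMono fun i : Fin k => N + (i : ℕ) := fun k N i j hij =>
    Nat.add_lt_add_left hij N
  have hex : ∀ a, ∃ L, Tendsto (fun N => ‖T N a‖) atTop (𝓝 L) := by
    intro a
    apply cauchySeq_tendsto_of_complete
    obtain ⟨k, hk⟩ := a.support.exists_nat_subset_range
    rw [Metric.cauchySeq_iff]
    intro ε hε
    obtain ⟨R, hR⟩ := (Set.finite_range fun i : Fin k => |a i|).bddAbove
    obtain ⟨N, hN⟩ := has k R ε hε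
    refine ⟨N, fun p hp q hq => ?_⟩
    rw [Real.dist_eq, hT p k a hk, hT q k a hk]
    exact hN _ _ (hshift k p) (hshift k q) (fun i => hp.trans (Nat.le_add_right _ _))
      (fun i => hq.trans (Nat.le_add_right _ _)) (fun i => a i) fun i => hR ⟨i, rfl⟩
  choose p hp using hex
  let inst0 : Norm (ℕ →₀ ℝ) := ⟨p⟩
  have hcore : SeminormedSpace.Core ℝ (ℕ →₀ ℝ) :=
    { norm_nonneg := fun a => ge_of_tendsto' (hp a) fun N => norm_nonneg _
      norm_smul := fun r a => tendsto_nhds_unique (hp (r • a)) 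
        (((hp a).const_mul ‖r‖).congr fun N => by rw [map_smul, norm_smul])
      norm_triangle := fun a b => le_of_tendsto_of_tendsto' (hp (a + b)) ((hp a).add (hp b))
        fun N => by rw [map_add]; exact norm_add_le _ _ }
  let inst1 : SeminormedAddCommGroup (ℕ →₀ ℝ) := SeminormedAddCommGroup.ofCore hcore
  let inst2 : NormedSpace ℝ (ℕ →₀ ℝ) := { norm_smul_le := fun r a => (hcore.norm_smul r a).le }
  let e : ℕ → UniformSpace.Completion (ℕ →₀ ℝ) := fun i => (Finsupp.single i (1 : ℝ) : ℕ →₀ ℝ)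
  have hsum : ∀ k (a : ℕ → ℝ), Tendsto (fun N => ‖∑ i ∈ Finset.range k, a i • x (σ (N + i))‖) atTop
      (𝓝 ‖∑ i ∈ Finset.range k, a i • e i‖) := by
    intro k a
    have h1 : ∑ i ∈ Finset.range k, a i • e i =
        ((∑ i ∈ Finset.range k, a i • Finsupp.single i (1 : ℝ) : ℕ →₀ ℝ) :
          UniformSpace.Completion (ℕ →₀ ℝ)) := by
      induction k with
      | zero => exact UniformSpace.Completion.coe_zero.symm
      | succ k ih =>
        rw [Finset.sum_range_succ, Finset.sum_range_succ, ih, UniformSpace.Completion.coe_add,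
          UniformSpace.Completion.coe_smul]
    rw [h1, UniformSpace.Completion.norm_coe]
    refine (hp (∑ i ∈ Finset.range k, a i • Finsupp.single i (1 : ℝ) : ℕ →₀ ℝ)).congr fun N => ?_
    simp [T]
  have he0 : ∀ i, e i ≠ 0 := by
    intro i
    have h1 : c ≤ ‖e i‖ := by
      have := hsum (i + 1) (Pi.single i 1)
      simp only [Pi.single_apply, ite_smul, one_smul, zero_smul, Finset.sum_ite_eq',
        Finset.mem_range, Nat.lt_succ_self, if_true] at this
      exact ge_of_tendsto' this fun N => (hcB _).1
    exact norm_pos_iff.1 (hc.trans_le h1)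
  have heC : HasBasisConstant C e := by
    intro m n a hmn
    refine le_of_tendsto_of_tendsto' (hsum m a) ((hsum n a).const_mul C) fun N => ?_
    exact hx.comp_strictMono (hσ.comp (fun i j hij => Nat.add_lt_add_left hij N :
      StrictMono fun i => N + i)) m n a hmn
  have hxσ := hx.comp_strictMono hσ
  refine ⟨σ, hσ, _, inferInstance, inferInstance, inferInstance, e,
    ⟨c, B, hc, fun n => hcB _⟩, hxσ.isBasicSequence fun n => ?_, heC.isBasicSequence he0, ?_⟩
  · exact norm_pos_iff.1 (hc.trans_le (hcB (σ n)).1)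
  · intro k ε hε
    obtain ⟨N, hN⟩ := has k 1 (ε / 2) (half_pos hε)
    refine ⟨N, fun n hn hnN a ha => ?_⟩
    have h1 := hsum k fun i => if h : i < k then a ⟨i, h⟩ else 0
    simp only [Finset.sum_range, Fin.is_lt, dif_pos, Fin.eta] at h1
    refine lt_of_le_of_lt (le_of_tendsto (tendsto_const_nhds.sub h1).abs
      ((eventually_ge_atTop N).mono fun M hM => ?_)) (half_lt_self hε)
    exact (hN n _ hn (hshift k M) (fun i => (hnN i).le)
      (fun i => hM.trans (Nat.le_add_right _ _)) a ha).le

end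

/-! ### Alternations and relays -/

/-- `IsAlternating g a b β c m`: there are `c` indices below `m` at which `g` lies alternately above
`b` and below `a`, starting above. The flag `β` tells whether the last one is above `b`; it is
`false` for the empty alternation. -/
inductive IsAlternating (g : ℕ → ℝ) (a b : ℝ) : Bool → ℕ → ℕ → Prop
  | start : IsAlternating g a b false 0 0
  | up {c m n : ℕ} : IsAlternating g a b false c m → m ≤ n → b ≤ g n →
      IsAlternating g a b true (c + 1) (n + 1)
  | down {c m n : ℕ} : IsAlternating g a b true c m → m ≤ n → g n ≤ a →
      IsAlternating g a b false (c + 1) (n + 1)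

/-- An alternation of length `2k` consists of `k` successive pairs, so every prescribed pattern of
length `k` can be selected from it. -/
theorem IsAlternating.exists_pattern {g : ℕ → ℝ} {a b : ℝ} (S : ℕ → Prop) {k : ℕ} :
    ∀ {β : Bool} {c m : ℕ}, IsAlternating g a b β c m → 2 * k ≤ c →
      ∃ n : ℕ → ℕ, (∀ i < k, n i < m) ∧ (∀ i j, i < j → j < k → n i < n j) ∧
        ∀ i < k, (S i → b ≤ g (n i)) ∧ (¬ S i → g (n i) ≤ a) := by
  classical
  induction k with
  | zero => exact fun _ _ => ⟨id, by simp, by simp, by simp⟩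
  | succ k ih =>
    -- The last two terms of the alternation are `u` (above `b`) and `d` (below `a`).
    suffices H : ∀ {β : Bool} {c m M u d : ℕ}, IsAlternating g a b β c m → 2 * k ≤ c → m ≤ u →
        m ≤ d → u < M → d < M → b ≤ g u → g d ≤ a → ∃ n : ℕ → ℕ, (∀ i < k + 1, n i < M) ∧
          (∀ i j, i < j → j < k + 1 → n i < n j) ∧
          ∀ i < k + 1, (S i → b ≤ g (n i)) ∧ (¬ S i → g (n i) ≤ a) by
      intro β c m h hc
      cases h with
      | start => omega
      | up h hmn hb =>
        cases h with
        | start => omega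
        | down h hmn' ha => exact H h (by omega) (by omega) (by omega) (by omega) (by omega) hb ha
      | down h hmn ha =>
        cases h with
        | up h hmn' hb => exact H h (by omega) (by omega) (by omega) (by omega) (by omega) hb ha
    intro β c m M u d h hc hu hd huM hdM hb ha
    obtain ⟨n, hnm, hn, hS⟩ := ih h hc
    have hlast : m ≤ (if S k then u else d) ∧ (if S k then u else d) < M := by
      split_ifs <;> exact ⟨by assumption, by assumption⟩
    refine ⟨fun i => if i < k then n i else if S k then u else d, fun i hi => ?_,
      fun i j hij hj => ?_, fun i hi => ?_⟩
    · by_cases hik : i < k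
      · simp only [hik, if_true]
        exact (hnm i hik).trans (hlast.1.trans_lt hlast.2)
      · simp only [hik, if_false]
        exact hlast.2
    · have hik : i < k := by omega
      simp only [hik, if_true]
      by_cases hjk : j < k
      · simp only [hjk, if_true]
        exact hn i j hij hjk
      · simp only [hjk, if_false]
        exact (hnm i hik).trans_le hlast.1
    · by_cases hik : i < k
      · simp only [hik, if_true]
        exact hS i hik
      · obtain rfl : i = k := by omega
        simp only [hik, if_false]
        exact ⟨fun h => by rwa [if_pos h], fun h => by rwa [if_neg h]⟩

/-- The relay driven by `g` is pushed towards `1` while `g > b` and towards `0` while `g < a`.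
It changes direction only when `g` alternates, and between two changes it varies by at most `1`;
the subtracted term is the room left in the current direction. -/
theorem exists_isAlternating_sum_abs_le {g s : ℕ → ℝ} {a b : ℝ} (hab : a < b) (hs0 : s 0 = 0)
    (hs : ∀ n, s (n + 1) = s n + (1 - s n) * min 1 (max 0 (g n - b)) -
      s n * min 1 (max 0 (a - g n))) (n : ℕ) :
    0 ≤ s n ∧ s n ≤ 1 ∧ ∃ (β : Bool) (c m : ℕ), m ≤ n ∧ IsAlternating g a b β c m ∧
      ∑ i ∈ Finset.range n, |s (i + 1) - s i| ≤ c - bif β then 1 - s n else s n := by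
  induction n with
  | zero => exact ⟨hs0.ge, by simp [hs0], false, 0, 0, le_rfl, .start, by simp [hs0]⟩
  | succ n ih =>
    obtain ⟨h0, h1, β, c, m, hm, halt, hV⟩ := ih
    rw [Finset.sum_range_succ]
    have hsn := hs n
    rcases le_or_gt b (g n) with hb | hb
    · rw [max_eq_left (by linarith : a - g n ≤ 0), min_eq_right zero_le_one, mul_zero,
        sub_zero] at hsn
      set α := min 1 (max 0 (g n - b)) with hα
      have hα0 : 0 ≤ α := le_min zero_le_one (le_max_left _ _)
      have hα1 : α ≤ 1 := min_le_left _ _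
      have hδ0 : 0 ≤ (1 - s n) * α := mul_nonneg (by linarith) hα0
      have hδ1 : (1 - s n) * α ≤ 1 - s n := mul_le_of_le_one_right (by linarith) hα1
      have habs : |s (n + 1) - s n| = s (n + 1) - s n := abs_of_nonneg (by linarith)
      refine ⟨by linarith, by linarith, true, ?_⟩
      cases β with
      | false =>
        refine ⟨c + 1, n + 1, le_rfl, halt.up hm hb, ?_⟩
        simp only [cond_false, cond_true] at hV ⊢
        push_cast
        linarith
      | true =>
        refine ⟨c, m, by omega, halt, ?_⟩
        simp only [cond_true] at hV ⊢
        linarith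
    rw [max_eq_left (by linarith : g n - b ≤ 0), min_eq_right zero_le_one, mul_zero,
      add_zero] at hsn
    rcases le_or_gt (g n) a with ha | ha
    · set α := min 1 (max 0 (a - g n)) with hα
      have hα0 : 0 ≤ α := le_min zero_le_one (le_max_left _ _)
      have hα1 : α ≤ 1 := min_le_left _ _
      have hδ0 : 0 ≤ s n * α := mul_nonneg h0 hα0
      have hδ1 : s n * α ≤ s n := mul_le_of_le_one_right h0 hα1
      have habs : |s (n + 1) - s n| = s n - s (n + 1) := by
        rw [abs_sub_comm]; exact abs_of_nonneg (by linarith)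
      refine ⟨by linarith, by linarith, false, ?_⟩
      cases β with
      | true =>
        refine ⟨c + 1, n + 1, le_rfl, halt.down hm ha, ?_⟩
        simp only [cond_false, cond_true] at hV ⊢
        push_cast
        linarith
      | false =>
        refine ⟨c, m, by omega, halt, ?_⟩
        simp only [cond_false] at hV ⊢
        linarith
    · rw [max_eq_left (by linarith : a - g n ≤ 0), min_eq_right zero_le_one, mul_zero,
        sub_zero] at hsn
      rw [hsn, sub_self, abs_zero, add_zero]
      exact ⟨h0, h1, β, c, m, by omega, halt, hV⟩

/-! ### Separation of levels by differences of semicontinuous functions -/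

section DBSC
variable {K : Type*} [TopologicalSpace K]

theorem const_mem_DBSC (c : ℝ) : (fun _ => c) ∈ DBSC K := by
  refine ⟨fun n => if n = 0 then 0 else ContinuousMap.const K c, |c|, by simp, fun k => ?_,
    fun k N => ?_⟩
  · refine tendsto_const_nhds.congr' ((eventually_ne_atTop 0).mono fun n hn => ?_)
    simp [hn]
  · cases N with
    | zero => simp
    | succ N => rw [Finset.sum_range_succ']; simp

theorem add_mem_DBSC {F G : K → ℝ} (hF : F ∈ DBSC K) (hG : G ∈ DBSC K) : F + G ∈ DBSC K := by
  obtain ⟨f, C, hf0, hf, hfC⟩ := hF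
  obtain ⟨g, D, hg0, hg, hgD⟩ := hG
  refine ⟨f + g, C + D, by simp [hf0, hg0], fun k => (hf k).add (hg k), fun k N => ?_⟩
  refine le_trans ?_ (add_le_add (hfC k N) (hgD k N))
  rw [← Finset.sum_add_distrib]
  refine Finset.sum_le_sum fun i _ => ?_
  refine le_trans (le_of_eq ?_) (abs_add_le _ _)
  simp only [Pi.add_apply, ContinuousMap.add_apply]
  congr 1; ring

theorem smul_mem_DBSC (c : ℝ) {F : K → ℝ} (hF : F ∈ DBSC K) : c • F ∈ DBSC K := by
  obtain ⟨f, C, hf0, hf, hfC⟩ := hF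
  refine ⟨c • f, |c| * C, by simp [hf0], fun k => (hf k).const_mul c, fun k N => ?_⟩
  calc _ = |c| * ∑ n ∈ Finset.range N, |f (n + 1) k - f n k| := by
        rw [Finset.mul_sum]
        refine Finset.sum_congr rfl fun i _ => ?_
        simp [← mul_sub, abs_mul]
    _ ≤ _ := by gcongr; exact hfC k N

theorem continuous_mem_DBSC {F : K → ℝ} [CompactSpace K] (hF : Continuous F) : F ∈ DBSC K := by
  obtain ⟨C, hC⟩ := (isCompact_range hF).isBounded.exists_norm_le
  refine ⟨fun n => if n = 0 then 0 else ⟨F, hF⟩, C, by simp, fun k => ?_, fun k N => ?_⟩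
  · refine tendsto_const_nhds.congr' ((eventually_ne_atTop 0).mono fun n hn => ?_)
    simp [hn]
  · have h : |F k| ≤ C := hC _ ⟨k, rfl⟩
    cases N with
    | zero => simpa using (abs_nonneg _).trans h
    | succ N => rw [Finset.sum_range_succ']; simpa using h

/-- `S` takes values in `[0, 1]`, equals `1` where `F > b` and `0` where `F < a`. -/
def Separates (S F : K → ℝ) (a b : ℝ) : Prop :=
  ∀ t, 0 ≤ S t ∧ S t ≤ 1 ∧ (b < F t → S t = 1) ∧ (F t < a → S t = 0)

/-- If the alternations of the sequences `f n t` between `a` and `b` have bounded length, then the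
limit of the corresponding relays is a member of `DBSC(K)` separating the levels `a` and `b`. -/
theorem exists_mem_DBSC_separates {F : K → ℝ} {f : ℕ → C(K, ℝ)}
    (hf : ∀ t, Tendsto (fun n => f n t) atTop (𝓝 (F t))) {a b : ℝ} (hab : a < b) {L : ℕ}
    (hL : ∀ t β c m, IsAlternating (fun n => f n t) a b β c m → c ≤ L) :
    ∃ S ∈ DBSC K, Separates S F a b := by
  let s : ℕ → C(K, ℝ) := fun n => Nat.rec 0 (fun n r =>
    ⟨fun t => r t + (1 - r t) * min 1 (max 0 (f n t - b)) - r t * min 1 (max 0 (a - f n t)),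
      by fun_prop⟩) n
  have hs : ∀ n t, s (n + 1) t = s n t + (1 - s n t) * min 1 (max 0 (f n t - b)) -
      s n t * min 1 (max 0 (a - f n t)) := fun n t => rfl
  have hinv := fun t n => exists_isAlternating_sum_abs_le (g := fun n => f n t)
    (s := fun n => s n t) hab rfl (fun n => hs n t) n
  have hV : ∀ t N, ∑ n ∈ Finset.range N, |s (n + 1) t - s n t| ≤ L := by
    intro t N
    obtain ⟨h0, h1, β, c, m, -, halt, hV⟩ := hinv t N
    have hc : (c : ℝ) ≤ L := by exact_mod_cast hL t β c m halt
    refine hV.trans ?_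
    cases β <;> simp only [cond_true, cond_false] <;> linarith
  have hex : ∀ t, ∃ S, Tendsto (fun n => s n t) atTop (𝓝 S) := by
    intro t
    apply cauchySeq_tendsto_of_complete
    apply cauchySeq_of_summable_dist
    refine summable_of_sum_range_le (c := L) (fun n => dist_nonneg) fun N => ?_
    refine (Finset.sum_le_sum fun i _ => ?_).trans (hV t N)
    rw [dist_comm, Real.dist_eq]
  choose S hS using hex
  refine ⟨S, ⟨s, L, rfl, hS, hV⟩, fun t => ⟨ge_of_tendsto' (hS t) fun n => (hinv t n).1,
    le_of_tendsto' (hS t) fun n => (hinv t n).2.1, ?_⟩⟩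
  -- The limit `S t` is a fixed point of the recursion driven by the constant value `F t`.
  have hfix : S t = S t + (1 - S t) * min 1 (max 0 (F t - b)) - S t * min 1 (max 0 (a - F t)) := by
    refine tendsto_nhds_unique ((tendsto_add_atTop_iff_nat 1).2 (hS t)) ?_
    simp only [hs]
    have h1 : Tendsto (fun n => min 1 (max 0 (f n t - b))) atTop (𝓝 (min 1 (max 0 (F t - b)))) :=
      tendsto_const_nhds.min (tendsto_const_nhds.max ((hf t).sub_const b))
    have h2 : Tendsto (fun n => min 1 (max 0 (a - f n t))) atTop (𝓝 (min 1 (max 0 (a - F t)))) :=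
      tendsto_const_nhds.min (tendsto_const_nhds.max ((hf t).const_sub a))
    exact ((hS t).add (((hS t).const_sub 1).mul h1)).sub ((hS t).mul h2)
  constructor
  · intro hb
    rw [max_eq_left (by linarith : a - F t ≤ 0), min_eq_right zero_le_one] at hfix
    have hpos : 0 < min 1 (max 0 (F t - b)) :=
      lt_min one_pos (lt_max_of_lt_right (sub_pos.2 hb))
    have : (1 - S t) * min 1 (max 0 (F t - b)) = 0 := by linarith
    rcases mul_eq_zero.1 this with h | h
    · linarith
    · exact absurd h hpos.ne'
  · intro ha
    rw [max_eq_left (by linarith : F t - b ≤ 0), min_eq_right zero_le_one] at hfix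
    have hpos : 0 < min 1 (max 0 (a - F t)) :=
      lt_min one_pos (lt_max_of_lt_right (sub_pos.2 ha))
    have : S t * min 1 (max 0 (a - F t)) = 0 := by linarith
    rcases mul_eq_zero.1 this with h | h
    · exact h
    · exact absurd h hpos.ne'

theorem mem_BaireHalf_of_forall_exists {F : K → ℝ} (hF : F ∈ BaireOne K)
    (h : ∀ ε > 0, ∃ G ∈ DBSC K, ∀ t, |G t - F t| ≤ ε) : F ∈ BaireHalf K := by
  choose! G hG hGF using h
  refine ⟨hF, fun n => G (1 / ((n : ℝ) + 1)), fun n => hG _ (by positivity), ?_⟩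
  rw [Metric.tendstoUniformly_iff]
  intro ε hε
  obtain ⟨N, hN⟩ := exists_nat_one_div_lt hε
  filter_upwards [eventually_ge_atTop N] with n hn t
  rw [dist_comm, Real.dist_eq]
  refine (hGF (1 / ((n : ℝ) + 1)) (by positivity) t).trans_lt (lt_of_le_of_lt ?_ hN)
  gcongr

/-- If all pairs of levels of `F` are separated by members of `DBSC(K)`, then `F` is a uniform limit
of step-like sums of such members. -/
theorem mem_BaireHalf_of_separates {F : K → ℝ} (hF : F ∈ BaireOne K)
    (h : ∀ a b, a < b → ∃ S ∈ DBSC K, Separates S F a b) : F ∈ BaireHalf K := by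
  refine mem_BaireHalf_of_forall_exists hF fun ε hε => ?_
  obtain ⟨f, ⟨M, hM⟩, hf⟩ := hF
  have hFM : ∀ t, |F t| ≤ M := fun t =>
    le_of_tendsto (hf t).abs (Eventually.of_forall fun n => hM n t)
  set δ := ε / 2 with hδ
  have hδ0 : 0 < δ := half_pos hε
  -- The levels `l j` cut the range of `F` into steps of height `δ`.
  let l : ℕ → ℝ := fun j => -M + j * δ
  have hl : ∀ j, l (j + 1) = l j + δ := fun j => by simp only [l]; push_cast; ring
  have hsep : ∀ j, ∃ S ∈ DBSC K, Separates S F (l j) (l (j + 1)) := fun j =>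
    h _ _ (by rw [hl]; linarith)
  choose S hS hSF using hsep
  let T : ℕ → K → ℝ := fun J => (fun _ => -M) + ∑ j ∈ Finset.range J, δ • S j
  have hT : ∀ J, T J ∈ DBSC K := by
    intro J
    induction J with
    | zero => simpa [T] using! const_mem_DBSC (-M)
    | succ J ih =>
      have : T (J + 1) = T J + δ • S J := by simp only [T, Finset.sum_range_succ]; abel
      rw [this]
      exact add_mem_DBSC ih (smul_mem_DBSC _ (hS J))
  have hT1 : ∀ J t, T (J + 1) t = T J t + δ * S J t := fun J t => by
    simp only [T, Finset.sum_range_succ, Pi.add_apply, Pi.smul_apply, smul_eq_mul]; ring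
  -- `T J` approximates `min F (l J)`; a second error `δ` can occur where `F t` equals a level.
  have key : ∀ t J, (l J < F t → T J t = l J) ∧ (F t = l J → |T J t - F t| ≤ δ) ∧
      (F t < l J → |T J t - F t| ≤ 2 * δ) := by
    intro t J
    induction J with
    | zero =>
      have h0 : T 0 t = -M := by simp [T]
      have h1 : l 0 = -M := by simp [l]
      have h2 := (abs_le.1 (hFM t)).1
      rw [h0, h1]
      refine ⟨fun _ => rfl, fun h => ?_, fun h => ?_⟩
      · rw [h, sub_self, abs_zero]; exact hδ0.le
      · linarith
    | succ J ih =>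
      obtain ⟨ih1, ih2, ih3⟩ := ih
      obtain ⟨hS0, hS1, hSb, hSa⟩ := hSF J t
      have h0 : 0 ≤ δ * S J t := mul_nonneg hδ0.le hS0
      have h1 : δ * S J t ≤ δ := mul_le_of_le_one_right hδ0.le hS1
      have hlJ := hl J
      rw [hT1]
      refine ⟨fun h => ?_, fun h => ?_, fun h => ?_⟩
      · rw [hSb h, ih1 (by linarith), hlJ]; ring
      · rw [ih1 (by linarith), abs_le]
        constructor <;> linarith
      · rcases lt_trichotomy (F t) (l J) with h' | h' | h'
        · rw [hSa h', mul_zero, add_zero]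
          exact ih3 h'
        · have := abs_le.1 (ih2 h')
          rw [abs_le]
          constructor <;> linarith
        · rw [ih1 h', abs_le]
          constructor <;> linarith
  obtain ⟨J, hJ⟩ := exists_nat_gt (2 * M / δ)
  rw [div_lt_iff₀ hδ0] at hJ
  refine ⟨T J, hT J, fun t => ?_⟩
  have := (key t J).2.2 (by have := (abs_le.1 (hFM t)).2; simp only [l]; linarith)
  linarith

/-- If `DBSC(K)` does not separate the levels `a < b` of `F`, then every sign pattern is realised by
values above `b` and below `a`, arbitrarily far out in any sequence converging to `F`. -/
theorem exists_pattern_of_not_separates {F : K → ℝ} {a b : ℝ} (hab : a < b)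
    (h : ∀ S ∈ DBSC K, ¬ Separates S F a b) {f : ℕ → C(K, ℝ)}
    (hf : ∀ t, Tendsto (fun n => f n t) atTop (𝓝 (F t))) (N k : ℕ) (P : Fin k → Prop) :
    ∃ (t : K) (n : Fin k → ℕ), StrictMono n ∧ (∀ i, N < n i) ∧
      ∀ i, (P i → b ≤ f (n i) t) ∧ (¬ P i → f (n i) t ≤ a) := by
  by_contra hcon
  have hL : ∀ t β c m, IsAlternating (fun n => f (n + (N + 1)) t) a b β c m → c ≤ 2 * k := by
    intro t β c m halt
    by_contra! hc
    obtain ⟨n, -, hn, hP⟩ := halt.exists_pattern (fun i => ∃ h : i < k, P ⟨i, h⟩) hc.le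
    refine hcon ⟨t, fun i => n i + (N + 1), fun i j hij => ?_, fun i => ?_, fun i => ?_⟩
    · exact Nat.add_lt_add_right (hn i j hij j.2) _
    · exact (Nat.lt_succ_self N).trans_le (Nat.le_add_left _ _)
    · simpa using hP i i.2
  obtain ⟨S, hS, hSF⟩ := exists_mem_DBSC_separates
    (fun t => (tendsto_add_atTop_iff_nat (N + 1)).2 (hf t)) hab hL
  exact h S hS hSF

end DBSC

/-! ### Spreading models of `ℓ₁` type -/

theorem norm_sum_smul_ellOneBasis (n : ℕ) (a : ℕ → ℝ) :
    ‖∑ i ∈ Finset.range n, a i • ellOneBasis i‖ = ∑ i ∈ Finset.range n, |a i| := by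
  have h := lp.norm_sum_single (E := fun _ : ℕ => ℝ) (p := 1) (by simp) a (Finset.range n)
  simp only [ENNReal.toReal_one, Real.rpow_one, Real.norm_eq_abs] at h
  rw [← h]
  congr 1
  refine Finset.sum_congr rfl fun i _ => ?_
  rw [ellOneBasis, ← lp.single_smul]
  simp

theorem equivalentSequences_ellOneBasis_of_norm_sum {E : Type*}
    [NormedAddCommGroup E] [NormedSpace ℝ E]
    {e : ℕ → E} {A B : ℝ} (hA : 0 < A) (hB : 0 < B)
    (h : ∀ (k : ℕ) (a : Fin k → ℝ), (∀ i, |a i| ≤ 1) →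
      A * ∑ i, |a i| ≤ ‖∑ i, a i • e i‖ ∧ ‖∑ i, a i • e i‖ ≤ B * ∑ i, |a i|) :
    EquivalentSequences e ellOneBasis := by
  refine ⟨A, B, hA, hB, fun n a => ?_⟩
  rw [norm_sum_smul_ellOneBasis, Finset.sum_range, Finset.sum_range]
  -- Dividing by `R` brings all coefficients into `[-1, 1]`.
  set R := 1 + ∑ i : Fin n, |a i| with hR
  have hR0 : 0 < R := by positivity
  have hle : ∀ i : Fin n, |R⁻¹ * a i| ≤ 1 := fun i => by
    rw [abs_mul, abs_of_pos (inv_pos.2 hR0), inv_mul_le_one₀ hR0]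
    have := Finset.single_le_sum (f := fun i : Fin n => |a i|) (fun i _ => abs_nonneg _)
      (Finset.mem_univ i)
    linarith
  have h1 := h n (fun i => R⁻¹ * a i) hle
  simp only [mul_smul, ← Finset.smul_sum, norm_smul, norm_inv, abs_mul, ← Finset.mul_sum,
    Real.norm_eq_abs, abs_inv, abs_of_pos hR0] at h1
  rw [mul_left_comm, mul_left_comm B, mul_le_mul_iff_of_pos_left (inv_pos.2 hR0),
    mul_le_mul_iff_of_pos_left (inv_pos.2 hR0)] at h1
  exact h1

/-- The lower `ℓ₁`-estimate: the sign pattern of the coefficients and the opposite pattern are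
realised at points `t` and `t'`, in general along different index tuples `n` and `n'`. The values
of the two combinations there differ by at least `(b - a) ∑ |xᵢ|`, while both norms are close to
that of the spreading model. -/
theorem IsSpreadingModel.equivalentSequences_ellOneBasis {K : Type*} [TopologicalSpace K]
    [CompactSpace K] {F : K → ℝ} {a b : ℝ} (hab : a < b) (h : ∀ S ∈ DBSC K, ¬ Separates S F a b)
    {f : ℕ → C(K, ℝ)} (hf : BddConvergesTo f F) {E : Type*} [NormedAddCommGroup E]
    [NormedSpace ℝ E] {e : ℕ → E} (he : IsSpreadingModel f e) :
    EquivalentSequences e ellOneBasis := by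
  obtain ⟨⟨c, M, hc, hcM⟩, -, -, hse⟩ := he
  have hM0 : 0 < M := hc.trans_le ((hcM 0).1.trans (hcM 0).2)
  refine equivalentSequences_ellOneBasis_of_norm_sum (A := (b - a) / 2) (B := M) (by linarith) hM0
    fun k x hx => ⟨?_, ?_⟩
  · refine le_of_forall_pos_le_add fun ε hε => ?_
    obtain ⟨N, hN⟩ := hse k ε hε
    obtain ⟨t, n, hn, hnN, hP⟩ :=
      exists_pattern_of_not_separates hab h hf.2 N k fun i => 0 ≤ x i
    obtain ⟨t', n', hn', hnN', hP'⟩ :=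
      exists_pattern_of_not_separates hab h hf.2 N k fun i => ¬ 0 ≤ x i
    have h1 := (abs_lt.1 (hN n hn hnN x hx)).2
    have h2 := (abs_lt.1 (hN n' hn' hnN' x hx)).2
    have h3 := (le_abs_self _).trans ((∑ i, x i • f (n i)).norm_coe_le_norm t)
    have h4 := (neg_le_abs _).trans ((∑ i, x i • f (n' i)).norm_coe_le_norm t')
    have h5 : (b - a) * ∑ i, |x i| ≤ (∑ i, x i • f (n i)) t - (∑ i, x i • f (n' i)) t' := by
      simp only [ContinuousMap.coe_sum, ContinuousMap.coe_smul, Finset.sum_apply, Pi.smul_apply,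
        smul_eq_mul]
      rw [← Finset.sum_sub_distrib, Finset.mul_sum]
      refine Finset.sum_le_sum fun i _ => ?_
      rw [← mul_sub, mul_comm]
      rcases le_or_gt 0 (x i) with hi | hi
      · rw [abs_of_nonneg hi]
        have := (hP i).1 hi
        have := (hP' i).2 (not_not.2 hi)
        gcongr
      · rw [abs_of_neg hi, ← neg_sub (f (n' i) t'), mul_neg, ← neg_mul]
        have := (hP i).2 (not_le.2 hi)
        have := (hP' i).1 (not_le.2 hi)
        have : 0 ≤ -x i := by linarith
        gcongr
    linarith
  · refine le_of_forall_pos_le_add fun ε hε => ?_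
    obtain ⟨N, hN⟩ := hse k ε hε
    have h1 := (abs_lt.1 (hN (fun i => N + 1 + i) (fun i j hij => Nat.add_lt_add_left hij _)
      (fun i => by omega) x hx)).1
    have h2 : ‖∑ i : Fin k, x i • f (N + 1 + i)‖ ≤ M * ∑ i, |x i| := by
      refine (norm_sum_le _ _).trans ?_
      rw [Finset.mul_sum]
      refine Finset.sum_le_sum fun i _ => ?_
      rw [norm_smul, Real.norm_eq_abs, mul_comm]
      gcongr
      exact (hcM _).2
    linarith

/-! ### Uniformly small convex combinations -/

open MeasureTheory in
/-- Dominated convergence for positive functionals on `C(K)`, which are integrals by the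
Riesz–Markov–Kakutani theorem. -/
theorem tendsto_positive_functional {K : Type*} [TopologicalSpace K] [CompactSpace K] [T2Space K]
    {l : StrongDual ℝ C(K, ℝ)} (hl : ∀ u : C(K, ℝ), 0 ≤ u → 0 ≤ l u) {φ : ℕ → C(K, ℝ)} {M : ℝ}
    (hM : ∀ n t, |φ n t| ≤ M) (hlim : ∀ t, Tendsto (fun n => φ n t) atTop (𝓝 0)) :
    Tendsto (fun n => l (φ n)) atTop (𝓝 0) := by
  borelize K
  let Λ : CompactlySupportedContinuousMap K ℝ →ₚ[ℝ] ℝ := PositiveLinearMap.mk₀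
    { toFun := fun u => l u.toContinuousMap
      map_add' := fun u v => map_add l u.toContinuousMap v.toContinuousMap
      map_smul' := fun c u => map_smul l c u.toContinuousMap }
    fun u hu => hl _ fun t => hu t
  let μ := RealRMK.rieszMeasure Λ
  have hint : ∀ u : C(K, ℝ), ∫ t, u t ∂μ = l u := fun u =>
    RealRMK.integral_rieszMeasure Λ (CompactlySupportedContinuousMap.continuousMapEquiv u)
  have h := tendsto_integral_of_dominated_convergence (μ := μ) (F := fun n t => φ n t)
    (f := fun _ => 0) (fun _ => M) (fun n => (φ n).continuous.aestronglyMeasurable)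
    (integrable_const M) (fun n => Eventually.of_forall fun t => hM n t)
    (Eventually.of_forall hlim)
  simpa only [hint, integral_zero] using h

/-- For a bounded pointwise null sequence there are convex combinations of far terms with values
everywhere below `ε`. Otherwise the Hahn–Banach theorem separates them from `{u | u < ε}` by
a functional `l`, which is positive and stays bounded away from `0` on the sequence. -/
theorem exists_convexCombination_lt {K : Type*} [TopologicalSpace K] [CompactSpace K] [T2Space K]
    {φ : ℕ → C(K, ℝ)} {B : ℝ} (hB : ∀ n t, |φ n t| ≤ B)
    (hlim : ∀ t, Tendsto (fun n => φ n t) atTop (𝓝 0)) {ε : ℝ} (hε : 0 < ε) (N : ℕ) :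
    ∃ M, N < M ∧ ∃ w : ℕ → ℝ, (∀ i, 0 ≤ w i) ∧ ∑ i ∈ Finset.Ico N M, w i = 1 ∧
      ∀ t, ∑ i ∈ Finset.Ico N M, w i * φ i t < ε := by
  let total : (ℕ →₀ ℝ) →ₗ[ℝ] ℝ := Finsupp.linearCombination ℝ fun _ => 1
  let W : Set (ℕ →₀ ℝ) := {w | (∀ i, 0 ≤ w i) ∧ (∀ i < N, w i = 0) ∧ total w = 1}
  have hW : Convex ℝ W := by
    rintro w ⟨h0, h1, h2⟩ w' ⟨h0', h1', h2'⟩ a b ha hb hab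
    refine ⟨fun i => ?_, fun i hi => ?_, ?_⟩
    · have := mul_nonneg ha (h0 i)
      have := mul_nonneg hb (h0' i)
      simp only [Finsupp.add_apply, Finsupp.smul_apply, smul_eq_mul]
      linarith
    · simp [h1 i hi, h1' i hi]
    · rw [map_add, map_smul, map_smul, h2, h2', smul_eq_mul, smul_eq_mul, mul_one, mul_one, hab]
  let O : Set C(K, ℝ) := {u | ∀ t, u t < ε}
  have hO : Convex ℝ O := by
    intro u hu v hv a b ha hb hab t
    exact convex_Iio ε (hu t) (hv t) ha hb hab
  have hOo : IsOpen O := by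
    have := ContinuousMap.isOpen_setOfPred_mapsTo (X := K) (Y := ℝ) isCompact_univ
      (isOpen_Iio (a := ε))
    convert this using 1
    ext u
    simp [O, Set.MapsTo]
  by_cases hdisj : Disjoint O (Finsupp.linearCombination ℝ φ '' W)
  · exfalso
    obtain ⟨l, u, hlO, hlW⟩ := geometric_hahn_banach_open hO hOo (hW.linear_image _) hdisj
    have hu : 0 < u := by simpa using hlO 0 fun t => hε
    have hpos : ∀ v : C(K, ℝ), 0 ≤ v → 0 ≤ l v := by
      intro v hv
      by_contra! hneg
      have h1 := hlO ((u / l v) • v) fun t => by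
        have : u / l v * v t ≤ 0 :=
          mul_nonpos_of_nonpos_of_nonneg (div_nonpos_of_nonneg_of_nonpos hu.le hneg.le) (hv t)
        exact this.trans_lt hε
      rw [map_smul, smul_eq_mul, div_mul_cancel₀ _ hneg.ne] at h1
      exact lt_irrefl _ h1
    have hlim0 := tendsto_positive_functional hpos hB hlim
    refine absurd (ge_of_tendsto hlim0 ((eventually_ge_atTop N).mono fun n hn => ?_)) (not_le.2 hu)
    refine hlW _ ⟨Finsupp.single n 1, ⟨fun i => ?_, fun i hi => ?_, ?_⟩, ?_⟩
    · rw [Finsupp.single_apply]; split_ifs <;> norm_num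
    · exact Finsupp.single_eq_of_ne (by omega)
    · simp [total]
    · simp
  · obtain ⟨_, hwO, w, ⟨h0, h1, h2⟩, rfl⟩ := Set.not_disjoint_iff.1 hdisj
    obtain ⟨m, hm⟩ := w.support.exists_nat_subset_range
    have hsub : w.support ⊆ Finset.Ico N (max m (N + 1)) := fun i hi => by
      have h3 := Finset.mem_range.1 (hm hi)
      have h4 : N ≤ i := by
        by_contra! h
        exact Finsupp.mem_support_iff.1 hi (h1 i h)
      rw [Finset.mem_Ico]
      omega
    refine ⟨max m (N + 1), by omega, w, h0, ?_, fun t => ?_⟩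
    · rw [← h2]
      simp only [total, Finsupp.linearCombination_apply]
      rw [Finsupp.sum_of_support_subset w hsub _ (by simp)]
      simp
    · have h3 := hwO t
      rw [Finsupp.linearCombination_apply, Finsupp.sum_of_support_subset w hsub _ (by simp)] at h3
      simpa using h3

/-! ### Convex block subsequences -/

/-- Convex combinations of arbitrarily far terms can be arranged into consecutive blocks. -/
theorem exists_convex_blocks {K : Type*} [TopologicalSpace K] {Φ : ℕ → ℕ → C(K, ℝ)} {ε : ℕ → ℝ}
    (h : ∀ n N, ∃ M, N < M ∧ ∃ w : ℕ → ℝ, (∀ i, 0 ≤ w i) ∧ ∑ i ∈ Finset.Ico N M, w i = 1 ∧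
      ∀ t, ∑ i ∈ Finset.Ico N M, w i * Φ n i t < ε n) :
    ∃ (p : ℕ → ℕ) (a : ℕ → ℝ), StrictMono p ∧ (∀ i, 0 ≤ a i) ∧
      ∀ n, ∑ i ∈ Finset.Ico (p n) (p (n + 1)), a i = 1 ∧
        ∀ t, ∑ i ∈ Finset.Ico (p n) (p (n + 1)), a i * Φ n i t < ε n := by
  choose M hM w hw0 hw1 hw using h
  let p : ℕ → ℕ := fun n => Nat.rec 0 M n
  have hp : StrictMono p := strictMono_nat_of_lt_succ fun n => hM n (p n)
  let a : ℕ → ℝ := fun i => ∑ m ∈ Finset.range (i + 1),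
    if i ∈ Finset.Ico (p m) (p (m + 1)) then w m (p m) i else 0
  have ha : ∀ n, ∀ i ∈ Finset.Ico (p n) (p (n + 1)), a i = w n (p n) i := by
    intro n i hi
    have hi' := Finset.mem_Ico.1 hi
    simp only [a]
    rw [Finset.sum_eq_single n, if_pos hi]
    · intro m _ hmn
      rw [if_neg]
      intro hm
      have hm' := Finset.mem_Ico.1 hm
      rcases lt_or_gt_of_ne hmn with hlt | hlt
      · have := hp.monotone (show m + 1 ≤ n from hlt)
        omega
      · have := hp.monotone (show n + 1 ≤ m from hlt)
        omega
    · intro hn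
      have := hp.le_apply (x := n)
      exact absurd (Finset.mem_range.2 (by omega)) hn
  refine ⟨p, a, hp, fun i => Finset.sum_nonneg fun m _ => ?_, fun n => ⟨?_, fun t => ?_⟩⟩
  · split_ifs
    exacts [hw0 _ _ _, le_rfl]
  · rw [Finset.sum_congr rfl (ha n)]
    exact hw1 n (p n)
  · rw [Finset.sum_congr rfl fun i hi => by rw [ha n i hi]]
    exact hw n (p n) t

theorem abs_sum_mul_sub_le {s : Finset ℕ} {w x : ℕ → ℝ} {c R : ℝ} (hw : ∀ i, 0 ≤ w i)
    (hw1 : ∑ i ∈ s, w i = 1) (hx : ∀ i ∈ s, |x i - c| ≤ R) : |∑ i ∈ s, w i * x i - c| ≤ R := by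
  calc |∑ i ∈ s, w i * x i - c| = |∑ i ∈ s, w i * (x i - c)| := by
        simp only [mul_sub, Finset.sum_sub_distrib, ← Finset.sum_mul, hw1, one_mul]
    _ ≤ ∑ i ∈ s, |w i * (x i - c)| := Finset.abs_sum_le_sum_abs _ _
    _ ≤ ∑ i ∈ s, w i * R := Finset.sum_le_sum fun i hi => by
        rw [abs_mul, abs_of_nonneg (hw i)]
        exact mul_le_mul_of_nonneg_left (hx i hi) (hw i)
    _ = R := by rw [← Finset.sum_mul, hw1, one_mul]

theorem IsConvexBlockSubsequence.bddConvergesTo {K : Type*} [TopologicalSpace K]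
    {f g : ℕ → C(K, ℝ)} {F : K → ℝ} (hg : IsConvexBlockSubsequence g f)
    (hf : BddConvergesTo f F) : BddConvergesTo g F := by
  obtain ⟨p, a, hp, ha, h⟩ := hg
  obtain ⟨⟨M, hM⟩, hlim⟩ := hf
  have hgt : ∀ n t, g n t = ∑ i ∈ Finset.Ico (p n) (p (n + 1)), a i * f i t := fun n t => by
    rw [(h n).2]; simp
  refine ⟨⟨M, fun n t => ?_⟩, fun t => ?_⟩
  · rw [hgt, ← sub_zero (∑ i ∈ _, _)]
    exact abs_sum_mul_sub_le ha (h n).1 fun i _ => by rw [sub_zero]; exact hM i t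
  · rw [Metric.tendsto_atTop]
    intro ε hε
    obtain ⟨N, hN⟩ := Metric.tendsto_atTop.1 (hlim t) (ε / 2) (half_pos hε)
    refine ⟨N, fun n hn => ?_⟩
    rw [Real.dist_eq, hgt]
    refine (abs_sum_mul_sub_le ha (h n).1 fun i hi => ?_).trans_lt (half_lt_self hε)
    exact (hN i (hn.trans (hp.le_apply.trans (Finset.mem_Ico.1 hi).1))).le

/-- Convex blocks of a sequence of bounded variation have bounded variation, here summed over
disjoint pairs of blocks. -/
theorem sum_abs_convex_block_sub_le {x a : ℕ → ℝ} {p : ℕ → ℕ} {C : ℝ}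
    (hx : ∀ N, ∑ n ∈ Finset.range N, |x (n + 1) - x n| ≤ C) (hp : StrictMono p)
    (ha : ∀ i, 0 ≤ a i) (ha1 : ∀ n, ∑ i ∈ Finset.Ico (p n) (p (n + 1)), a i = 1)
    {q : ℕ → ℕ} (hq : StrictMono q) (k : ℕ) :
    ∑ j ∈ Finset.range k, |∑ i ∈ Finset.Ico (p (q (2 * j))) (p (q (2 * j) + 1)), a i * x i -
      ∑ i ∈ Finset.Ico (p (q (2 * j + 1))) (p (q (2 * j + 1) + 1)), a i * x i| ≤ 2 * C := by
  let V : ℕ → ℝ := fun N => ∑ n ∈ Finset.range N, |x (n + 1) - x n|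
  have hVmono : Monotone V := monotone_nat_of_le_succ fun n => by
    simp only [V, Finset.sum_range_succ]
    linarith [abs_nonneg (x (n + 1) - x n)]
  have hVx : ∀ m n, m ≤ n → |x n - x m| ≤ V n - V m := by
    intro m n hmn
    induction n, hmn using Nat.le_induction with
    | base => simp
    | succ n _ ih =>
      have h1 : V (n + 1) = V n + |x (n + 1) - x n| := Finset.sum_range_succ _ _
      have h2 := abs_sub_le (x (n + 1)) (x n) (x m)
      linarith
  let v : ℕ → ℝ := fun n => V (p n)
  have hv : Monotone v := hVmono.comp hp.monotone
  -- Both convex combinations are compared with the first term of the first block.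
  have hblock : ∀ m n r, m ≤ n → n < r →
      |∑ i ∈ Finset.Ico (p n) (p (n + 1)), a i * x i - x (p m)| ≤ v r - v m := by
    intro m n r hmn hnr
    refine abs_sum_mul_sub_le ha (ha1 n) fun i hi => ?_
    have hi' := Finset.mem_Ico.1 hi
    refine (hVx (p m) i ((hp.monotone hmn).trans hi'.1)).trans ?_
    have := hVmono (hi'.2.le.trans (hp.monotone (Nat.succ_le_of_lt hnr)))
    simp only [v]
    linarith
  have hstep : ∀ j, |∑ i ∈ Finset.Ico (p (q (2 * j))) (p (q (2 * j) + 1)), a i * x i -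
      ∑ i ∈ Finset.Ico (p (q (2 * j + 1))) (p (q (2 * j + 1) + 1)), a i * x i| ≤
        2 * (v (q (2 * (j + 1))) - v (q (2 * j))) := by
    intro j
    have hq1 : q (2 * j) < q (2 * j + 1) := hq (by omega)
    have hq2 : q (2 * j + 1) < q (2 * (j + 1)) := hq (by omega)
    have h1 := hblock (q (2 * j)) (q (2 * j)) _ le_rfl (hq1.trans hq2)
    have h2 := hblock (q (2 * j)) (q (2 * j + 1)) _ hq1.le hq2
    rw [abs_le] at h1 h2 ⊢
    constructor <;> linarith
  refine (Finset.sum_le_sum fun j _ => hstep j).trans ?_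
  rw [← Finset.mul_sum, Finset.sum_range_sub fun j => v (q (2 * j))]
  have h1 : v (q (2 * k)) ≤ C := hx _
  have h2 : 0 ≤ v (q (2 * 0)) := Finset.sum_nonneg fun n _ => abs_nonneg _
  linarith

/-- If `F` lies in `B_{1/2}(K)`, then every bounded sequence converging to `F` has a convex block
subsequence which, for each `ε`, is eventually uniformly `ε`-close to a sequence of pointwise
bounded variation. One block subsequence serves all `ε`: its `n`-th term is adapted to the first
`n + 1` of countably many approximations of `F` in `DBSC(K)`. -/
theorem exists_convexBlockSubsequence_near_DBSC {K : Type*} [TopologicalSpace K] [CompactSpace K]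
    [T2Space K] {F : K → ℝ} (hF : F ∈ BaireHalf K) {f : ℕ → C(K, ℝ)} (hf : BddConvergesTo f F) :
    ∃ g, IsConvexBlockSubsequence g f ∧ ∀ ε > 0, ∃ (h : ℕ → K → ℝ) (C : ℝ) (n₀ : ℕ),
      (∀ n, n₀ ≤ n → ∀ t, |g n t - h n t| ≤ ε) ∧
      ∀ q : ℕ → ℕ, StrictMono q → ∀ k t,
        ∑ j ∈ Finset.range k, |h (q (2 * j)) t - h (q (2 * j + 1)) t| ≤ C := by
  obtain ⟨-, G, hG, hGF⟩ := hF
  let δ : ℕ → ℝ := fun j => 1 / ((j : ℝ) + 1)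
  have hδ : ∀ j, 0 < δ j := fun j => by positivity
  have hG' : ∀ j, ∃ r, ∀ t, |F t - G r t| < δ j := fun j =>
    (Metric.tendstoUniformly_iff.1 hGF (δ j) (hδ j)).exists
  choose r hr using hG'
  choose h C h0 hlim hC using fun j => hG (r j)
  have hbd : ∀ j n t, |h j n t| ≤ C j := by
    intro j n t
    refine le_trans ?_ (hC j t n)
    refine le_trans (le_of_eq ?_) (Finset.abs_sum_le_sum_abs _ _)
    rw [Finset.sum_range_sub fun n => h j n t, h0]
    simp
  obtain ⟨⟨M, hM⟩, hfF⟩ := id hf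
  -- `Φ n i` measures by how much `f i` misses the tolerances for the first `n + 1` approximations.
  let Φ : ℕ → ℕ → C(K, ℝ) := fun n i =>
    ⟨fun t => ∑ j ∈ Finset.range (n + 1), max 0 (|f i t - h j i t| - δ j), by fun_prop⟩
  have hΦ : ∀ n i t, Φ n i t = ∑ j ∈ Finset.range (n + 1), max 0 (|f i t - h j i t| - δ j) :=
    fun n i t => rfl
  have hΦlim : ∀ n t, Tendsto (fun i => Φ n i t) atTop (𝓝 0) := by
    intro n t
    simp only [hΦ]
    suffices H : ∀ j ∈ Finset.range (n + 1),
        Tendsto (fun i => max 0 (|f i t - h j i t| - δ j)) atTop (𝓝 0) by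
      simpa using tendsto_finsetSum _ H
    intro j _
    have h1 : Tendsto (fun i => max 0 (|f i t - h j i t| - δ j)) atTop
        (𝓝 (max 0 (|F t - G (r j) t| - δ j))) :=
      tendsto_const_nhds.max ((((hfF t).sub (hlim j t)).abs).sub_const _)
    rwa [max_eq_left (by linarith [hr j t])] at h1
  have hΦbd : ∀ n, ∃ B, ∀ i t, |Φ n i t| ≤ B := by
    intro n
    refine ⟨∑ j ∈ Finset.range (n + 1), |M + C j|, fun i t => ?_⟩
    rw [hΦ, abs_of_nonneg (Finset.sum_nonneg fun j _ => le_max_left _ _)]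
    refine Finset.sum_le_sum fun j _ => max_le (abs_nonneg _) ?_
    have h1 := abs_sub (f i t) (h j i t)
    have h2 := hM i t
    have h3 := hbd j i t
    have h4 := le_abs_self (M + C j)
    have h5 := hδ j
    linarith
  obtain ⟨p, a, hp, ha, hpa⟩ := exists_convex_blocks (Φ := Φ) (ε := δ) fun n N => by
    obtain ⟨B, hB⟩ := hΦbd n
    exact exists_convexCombination_lt hB (hΦlim n) (hδ n) N
  refine ⟨fun n => ∑ i ∈ Finset.Ico (p n) (p (n + 1)), a i • f i,
    ⟨p, a, hp, ha, fun n => ⟨(hpa n).1, rfl⟩⟩, fun ε hε => ?_⟩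
  obtain ⟨j, hj⟩ := exists_nat_one_div_lt (half_pos hε)
  refine ⟨fun n t => ∑ i ∈ Finset.Ico (p n) (p (n + 1)), a i * h j i t, 2 * C j, j,
    fun n hn t => ?_, fun q hq k t => sum_abs_convex_block_sub_le (hC j t) hp ha
      (fun n => (hpa n).1) hq k⟩
  have hδn : δ n ≤ δ j := by simp only [δ]; gcongr
  simp only [ContinuousMap.coe_sum, ContinuousMap.coe_smul, Finset.sum_apply, Pi.smul_apply,
    smul_eq_mul]
  rw [← Finset.sum_sub_distrib]
  calc |∑ i ∈ Finset.Ico (p n) (p (n + 1)), (a i * f i t - a i * h j i t)|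
      ≤ ∑ i ∈ Finset.Ico (p n) (p (n + 1)), (a i * δ j + a i * Φ n i t) := by
        refine (Finset.abs_sum_le_sum_abs _ _).trans (Finset.sum_le_sum fun i _ => ?_)
        rw [← mul_sub, abs_mul, abs_of_nonneg (ha i), ← mul_add]
        refine mul_le_mul_of_nonneg_left ?_ (ha i)
        have h1 : max 0 (|f i t - h j i t| - δ j) ≤ Φ n i t :=
          Finset.single_le_sum (f := fun j => max 0 (|f i t - h j i t| - δ j))
            (fun j _ => le_max_left _ _) (Finset.mem_range.2 (by omega))
        linarith [le_max_right 0 (|f i t - h j i t| - δ j)]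
    _ ≤ δ j + δ n := by
        rw [Finset.sum_add_distrib, ← Finset.sum_mul, (hpa n).1, one_mul]
        linarith [(hpa n).2 t]
    _ ≤ ε := by
        have : δ j < ε / 2 := hj
        linarith

theorem sum_range_two_mul_alternating (x : ℕ → ℝ) (k : ℕ) :
    ∑ i ∈ Finset.range (2 * k), (-1) ^ i * x i =
      ∑ j ∈ Finset.range k, (x (2 * j) - x (2 * j + 1)) := by
  induction k with
  | zero => simp
  | succ k ih =>
    rw [show 2 * (k + 1) = 2 * k + 1 + 1 by ring, Finset.sum_range_succ, Finset.sum_range_succ, ih,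
      Finset.sum_range_succ _ k]
    simp [pow_succ, pow_mul]
    ring

/-- Alternating sums of sequences of bounded variation are bounded, which excludes the lower
`ℓ₁`-estimate for the vectors `∑ (-1)ⁱ eᵢ`. -/
theorem IsSpreadingModel.not_equivalentSequences_ellOneBasis {K : Type*} [TopologicalSpace K]
    [CompactSpace K] {g : ℕ → C(K, ℝ)}
    (hg : ∀ ε > 0, ∃ (h : ℕ → K → ℝ) (C : ℝ) (n₀ : ℕ),
      (∀ n, n₀ ≤ n → ∀ t, |g n t - h n t| ≤ ε) ∧
      ∀ q : ℕ → ℕ, StrictMono q → ∀ k t,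
        ∑ j ∈ Finset.range k, |h (q (2 * j)) t - h (q (2 * j + 1)) t| ≤ C)
    {φ : ℕ → ℕ} (hφ : StrictMono φ) {E : Type*} [NormedAddCommGroup E]
    [NormedSpace ℝ E] {e : ℕ → E} (he : IsSpreadingModel (g ∘ φ) e) :
    ¬ EquivalentSequences e ellOneBasis := by
  rintro ⟨A, _, hA, _, hAe⟩
  obtain ⟨h, C, n₀, hgh, hC⟩ := hg (A / 2) (half_pos hA)
  obtain ⟨k, hk⟩ := exists_nat_gt ((|C| + 1) / A)
  rw [div_lt_iff₀ hA] at hk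
  obtain ⟨N, hN⟩ := he.2.2.2 (2 * k) 1 one_pos
  let q : ℕ → ℕ := fun i => φ (N + n₀ + 1 + i)
  have hq : StrictMono q := hφ.comp fun i j hij => Nat.add_lt_add_left hij _
  have hq0 : ∀ i, n₀ ≤ q i := fun i => by
    have := hφ.le_apply (x := N + n₀ + 1 + i)
    simp only [q]
    omega
  have h1 := (hAe (2 * k) fun i => (-1) ^ i).1
  rw [norm_sum_smul_ellOneBasis] at h1
  simp only [abs_pow, abs_neg, abs_one, one_pow, Finset.sum_const, Finset.card_range,
    nsmul_eq_mul, mul_one] at h1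
  have h2 := hN (fun i => N + n₀ + 1 + i) (fun i j hij => Nat.add_lt_add_left hij _)
    (fun i => by omega) (fun i => (-1) ^ (i : ℕ)) (fun i => by simp)
  rw [Fin.sum_univ_eq_sum_range (fun i => (-1 : ℝ) ^ i • (g ∘ φ) (N + n₀ + 1 + i)),
    Fin.sum_univ_eq_sum_range (fun i => (-1 : ℝ) ^ i • e i)] at h2
  have h3 : ‖∑ i ∈ Finset.range (2 * k), (-1 : ℝ) ^ i • (g ∘ φ) (N + n₀ + 1 + i)‖ ≤
      |C| + k * A := by
    rw [ContinuousMap.norm_le _ (by positivity)]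
    intro t
    have h4 : (∑ i ∈ Finset.range (2 * k), (-1 : ℝ) ^ i • (g ∘ φ) (N + n₀ + 1 + i)) t =
        ∑ j ∈ Finset.range k, (g (q (2 * j)) t - g (q (2 * j + 1)) t) := by
      rw [← sum_range_two_mul_alternating (fun i => g (q i) t)]
      simp [q]
    rw [h4, Real.norm_eq_abs]
    calc |∑ j ∈ Finset.range k, (g (q (2 * j)) t - g (q (2 * j + 1)) t)|
        ≤ ∑ j ∈ Finset.range k, (|h (q (2 * j)) t - h (q (2 * j + 1)) t| + A) := by
          refine (Finset.abs_sum_le_sum_abs _ _).trans (Finset.sum_le_sum fun j _ => ?_)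
          have h5 := abs_le.1 (hgh _ (hq0 (2 * j)) t)
          have h6 := abs_le.1 (hgh _ (hq0 (2 * j + 1)) t)
          have h7 := neg_abs_le (h (q (2 * j)) t - h (q (2 * j + 1)) t)
          have h8 := le_abs_self (h (q (2 * j)) t - h (q (2 * j + 1)) t)
          rw [abs_le]
          constructor <;> linarith
      _ ≤ |C| + k * A := by
          rw [Finset.sum_add_distrib, Finset.sum_const, Finset.card_range, nsmul_eq_mul]
          gcongr
          exact (hC q hq k t).trans (le_abs_self C)
  have h9 := (abs_lt.1 h2).1
  push_cast at h1
  linarith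

/-! ### The characterization of `B_{1/2}(K)` -/

theorem exists_subsequence_isSpreadingModel {K : Type*} [TopologicalSpace K] [CompactSpace K]
    {F : K → ℝ} {f : ℕ → C(K, ℝ)} (hf : BddConvergesTo f F) (hF : ¬ Continuous F) :
    ∃ φ : ℕ → ℕ, StrictMono φ ∧ ∃ (E : Type) (_ : NormedAddCommGroup E) (_ : NormedSpace ℝ E)
      (_ : CompleteSpace E) (e : ℕ → E), IsSpreadingModel (f ∘ φ) e := by
  obtain ⟨σ, C, hσ, hC, hsn⟩ := exists_strictMono_hasBasisConstant hf hF
  obtain ⟨τ, hτ, h⟩ := hC.exists_isSpreadingModel hsn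
  exact ⟨σ ∘ τ, hσ.comp hτ, h⟩

theorem BddConvergesTo.comp_strictMono {K : Type*} [TopologicalSpace K] {F : K → ℝ}
    {f : ℕ → C(K, ℝ)} (hf : BddConvergesTo f F) {φ : ℕ → ℕ} (hφ : StrictMono φ) :
    BddConvergesTo (f ∘ φ) F := by
  obtain ⟨⟨M, hM⟩, hlim⟩ := hf
  exact ⟨⟨M, fun n => hM (φ n)⟩, fun t => (hlim t).comp hφ.tendsto_atTop⟩

theorem theorem3p7 {K : Type*} [MetricSpace K] [CompactSpace K] (F : K → ℝ)
    (hF : F ∈ BaireOne K) :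
    (¬ Continuous F →
      (∀ f : ℕ → C(K, ℝ), BddConvergesTo f F →
        ∀ (E : Type) [NormedAddCommGroup E] [NormedSpace ℝ E] [CompleteSpace E] (e : ℕ → E),
          IsSpreadingModel f e → EquivalentSequences e ellOneBasis) →
      F ∉ BaireHalf K) ∧
    (F ∉ BaireHalf K ↔
      ∃ f : ℕ → C(K, ℝ), BddConvergesTo f F ∧
        ∀ g : ℕ → C(K, ℝ), IsConvexBlockSubsequence g f →
          ∃ φ : ℕ → ℕ, StrictMono φ ∧ HasEllOneSpreadingModel (g ∘ φ)) := by
  refine ⟨fun hFc hsp hFh => ?_, fun hFh => ?_, ?_⟩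
  · obtain ⟨f, hf⟩ := hF
    obtain ⟨g, hg, hgh⟩ := exists_convexBlockSubsequence_near_DBSC hFh hf
    have hgF := hg.bddConvergesTo hf
    obtain ⟨φ, hφ, E, i₁, i₂, i₃, e, he⟩ := exists_subsequence_isSpreadingModel hgF hFc
    exact he.not_equivalentSequences_ellOneBasis hgh hφ
      (hsp _ (hgF.comp_strictMono hφ) E e he)
  · have hFc : ¬ Continuous F := fun hc => hFh
      (mem_BaireHalf_of_forall_exists hF fun ε hε =>
        ⟨F, continuous_mem_DBSC hc, fun t => by rw [sub_self, abs_zero]; exact hε.le⟩)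
    have hab : ∃ a b, a < b ∧ ∀ S ∈ DBSC K, ¬ Separates S F a b := by
      by_contra! h
      exact hFh (mem_BaireHalf_of_separates hF h)
    obtain ⟨a, b, hab, hsep⟩ := hab
    obtain ⟨f, hf⟩ := hF
    refine ⟨f, hf, fun g hg => ?_⟩
    have hgF := hg.bddConvergesTo hf
    obtain ⟨φ, hφ, E, i₁, i₂, i₃, e, he⟩ := exists_subsequence_isSpreadingModel hgF hFc
    exact ⟨φ, hφ, E, i₁, i₂, i₃, e, he,
      he.equivalentSequences_ellOneBasis hab hsep (hgF.comp_strictMono hφ)⟩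
  · rintro ⟨f, hf, h⟩ hFh
    obtain ⟨g, hg, hgh⟩ := exists_convexBlockSubsequence_near_DBSC hFh hf
    obtain ⟨φ, hφ, E, _, _, _, e, he, heq⟩ := h g hg
    exact he.not_equivalentSequences_ellOneBasis hgh hφ heq
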